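/- Let $\mathbb{F}_q$ be a finite field with $q$ elements, $A=\mathbb{F}_q[\theta]$, $K_\infty=\mathbb{F}_q((\theta^{-1}))$ with $\|\theta\|=q$, and let $\mathbb{C}_\infty$ be the completion of an algebraic closure of $K_\infty$. Let $\Omega=A\,d\theta$ be the module of Kähler differentials of $A$ over $\mathbb{F}_q$. For an $\mathbb{F}_q$-vector space $M$ with the discrete topology, let $\hat M=\mathrm{Hom}_{\mathbb{F}_q}(M,\mathbb{F}_q)$ with the topology of pointwise convergence (the Pontryagin dual of $M$), and let $\mathbb{C}_\infty\hat\otimes M:=\mathrm{Hom}^{cont}_{\mathbb{F}_q}(\hat M,\mathbb{C}_\infty)$, where $c\otimes m$ is the map $g\mapsto g(m)c$. If $M$ is an $A$-module, then for $c\in\mathbb{C}_\infty$, $a\in A$ and $f\in\mathbb{C}_\infty\hat\otimes M$ the product $(c\otimes a)f$ is the map $g\mapsto c\,f(g\circ a)$, and the Frobenius twist $f^{(1)}$ is the map $g\mapsto f(g)^q$. Let $\phi$ be a Drinfeld $A$-module of rank $r\geq1$ over $\mathbb{C}_\infty$: a ring homomorphism $a\mapsto\phi_a$ from $A$ to $\mathbb{C}_\infty[\tau]\subseteq\mathrm{End}_{\mathbb{F}_q}(\mathbb{C}_\infty)$,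 where $\tau(x)=x^q$, such that for $a\neq0$ the operator $\phi_a$ has degree $r\deg a$ in $\tau$ and constant term $a$. Let $\Lambda\subseteq\mathbb{C}_\infty$ be its period lattice: the finitely generated $A$-submodule of rank $r$, with finitely many elements in each ball, such that $\phi_a(\exp_\Lambda(x))=\exp_\Lambda(ax)$ for all $a\in A$ and $x\in\mathbb{C}_\infty$, where $\exp_\Lambda(x)=x\prod_{\lambda\in\Lambda\setminus\{0\}}(1-x/\lambda)$. Let $\zeta_\phi=-\sum_{\lambda\in\Lambda\setminus\{0\}}\lambda^{-1}\otimes\lambda\in\mathbb{C}_\infty\hat\otimes\Lambda$ be the universal dual special function of $\phi$, that is, the map $g\mapsto-\sum_{\lambda\in\Lambda\setminus\{0\}}g(\lambda)\lambda^{-1}$. Let $\omega_\phi\in\mathbb{C}_\infty\hat\otimes\mathrm{Hom}_A(\Lambda,\Omega)$ be the universal special function of $\phi$: the unique element that, for all $b\in K_\infty$ and $\lambda\in\Lambda$, takes the value $\exp_\Lambda(b\lambda)$ at the functional $\mu\mapsto\mathrm{res}(b\,\mu(\lambda))$, where $\mathrm{res}(f\,d\theta)$ denotes the coefficient of $\theta^{-1}$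 in $f\in K_\infty$. Let $$ev:(\mathbb{C}_\infty\hat\otimes\Lambda)\otimes(\mathbb{C}_\infty\hat\otimes\mathrm{Hom}_A(\Lambda,\Omega))\to\mathbb{C}_\infty\hat\otimes\Omega,\qquad \sum_i c_i\otimes\lambda_i\;\otimes\;\sum_j d_j\otimes\mu_j\;\mapsto\;\sum_{i,j}c_id_j\otimes\mu_j(\lambda_i),$$ be the canonical pairing. Then the following holds in $\mathbb{C}_\infty\hat\otimes\Omega$: $$ev(\zeta_\phi\otimes\omega_\phi)=\frac{d\theta}{\theta\otimes1-1\otimes\theta},$$ that is, $ev(\zeta_\phi\otimes\omega_\phi)$ is the unique $g\in\mathbb{C}_\infty\hat\otimes\Omega$ with $(\theta\otimes1-1\otimes\theta)\,g=1\otimes d\theta$. Moreover, if $r\geq2$, then $$ev(\zeta_\phi\otimes\omega_\phi^{(1)})=0.$$ -/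

import Mathlib

open Polynomial Filter Topology
open scoped NNReal WithZero KaehlerDifferential

noncomputable section

/-- `K∞ = F((1/θ))`, the completion of `F(θ)` at infinity: Laurent series in the variable `1/θ`. -/
def KInf (F : Type*) [Field F] : Type _ := LaurentSeries F

namespace KInf

variable (F : Type*) [Field F]

instance : Field (KInf F) := inferInstanceAs (Field (LaurentSeries F))
instance : Algebra F (KInf F) := (HahnSeries.C : F →+* LaurentSeries F).toAlgebra
instance : Valued (KInf F) ℤᵐ⁰ := inferInstanceAs (Valued (LaurentSeries F) ℤᵐ⁰)
instance : CompleteSpace (KInf F) := inferInstanceAs (CompleteSpace (LaurentSeries F))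

/-- The element `θ`, i.e. the inverse of the variable of the Laurent series. -/
def theta : KInf F := (HahnSeries.single (-1 : ℤ) (1 : F) : LaurentSeries F)

/-- `F[θ] → K∞`. -/
instance : Algebra F[X] (KInf F) := (aeval (theta F)).toRingHom.toAlgebra

instance : IsScalarTower F F[X] (KInf F) :=
  IsScalarTower.of_algebraMap_eq fun x => ((aeval (theta F)).commutes x).symm

variable [Finite F]

lemma one_lt_card : (1 : ℝ≥0) < (Nat.card F : ℝ≥0) := by
  exact_mod_cast Finite.one_lt_card

lemma valuation_theta : Valued.v (theta F) = WithZero.exp (1 : ℤ) := by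
  have := LaurentSeries.valuation_single_zpow F (-1)
  exact this.trans (by simp)

open MonoidWithZeroHom MonoidWithZeroHom.ValueGroup₀ in
/-- The normalisation of the absolute value: `‖θ‖ = q`. -/
instance : (Valued.v : Valuation (KInf F) ℤᵐ⁰).RankOne where
  hom' := (WithZeroMulInt.toNNReal (one_lt_card F).ne_zero).comp embedding
  strictMono' := (WithZeroMulInt.toNNReal_strictMono (one_lt_card F)).comp embedding_strictMono
  exists_val_nontrivial := ⟨theta F, by rw [valuation_theta]; simp, by
    rw [valuation_theta, ← WithZero.exp_zero]; simp⟩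

instance : NontriviallyNormedField (KInf F) :=
  Valued.toNontriviallyNormedField (KInf F) ℤᵐ⁰

instance : IsUltrametricDist (KInf F) :=
  IsUltrametricDist.isUltrametricDist_of_forall_norm_add_le_max_norm
    (Valued.isNonarchimedean_norm (KInf F) ℤᵐ⁰)

lemma norm_theta : ‖theta F‖ = Nat.card F := by
  have h : (‖theta F‖ : ℝ) =
      (WithZeroMulInt.toNNReal (one_lt_card F).ne_zero (Valued.v (theta F)) : ℝ≥0) := by
    rw [← Valuation.embedding_restrict]; rfl
  rw [h, valuation_theta]
  rw [WithZeroMulInt.toNNReal_neg_apply _ (by simp)]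
  simp [WithZero.exp]

end KInf

/-- The algebraic closure of `K∞`, with the unique extension of the absolute value. -/
abbrev KInfAlg (F : Type*) [Field F] : Type _ := AlgebraicClosure (KInf F)

namespace KInfAlg

variable (F : Type*) [Field F] [Finite F]

instance : NontriviallyNormedField (KInfAlg F) :=
  spectralNorm.nontriviallyNormedField (KInf F) (KInfAlg F)
instance : NormedAlgebra (KInf F) (KInfAlg F) := spectralNorm.normedAlgebra _ _
instance : IsUltrametricDist (KInfAlg F) :=
  IsUltrametricDist.isUltrametricDist_of_forall_norm_add_le_max_norm
    (isNonarchimedean_spectralNorm (K := KInf F) (L := KInfAlg F))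
instance : CompletableTopField (KInfAlg F) :=
  (NormedField.toValued (K := KInfAlg F)).completable
end KInfAlg

/-- `ℂ∞`, the completion of the algebraic closure of `K∞`. -/
def CInf (F : Type*) [Field F] [Finite F] : Type _ := UniformSpace.Completion (KInfAlg F)

namespace CInf
variable (F : Type*) [Field F] [Finite F]
instance : NormedField (CInf F) := inferInstanceAs (NormedField (UniformSpace.Completion (KInfAlg F)))
instance : CompleteSpace (CInf F) :=
  inferInstanceAs (CompleteSpace (UniformSpace.Completion (KInfAlg F)))
instance : NormedAlgebra (KInf F) (CInf F) :=
  inferInstanceAs (NormedAlgebra (KInf F) (UniformSpace.Completion (KInfAlg F)))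
instance : IsUltrametricDist (CInf F) := IsUltrametricDist.of_normedAlgebra (KInf F)
instance : Algebra F[X] (CInf F) := ((algebraMap (KInf F) (CInf F)).comp (algebraMap F[X] (KInf F))).toAlgebra
instance : Algebra F (CInf F) := ((algebraMap (KInf F) (CInf F)).comp (algebraMap F (KInf F))).toAlgebra
instance : IsScalarTower F[X] (KInf F) (CInf F) := IsScalarTower.of_algebraMap_eq fun _ => rfl
instance : IsScalarTower F (KInf F) (CInf F) := IsScalarTower.of_algebraMap_eq fun _ => rfl
instance : IsScalarTower F F[X] (CInf F) := IsScalarTower.of_algebraMap_eq fun x => by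
  rw [IsScalarTower.algebraMap_apply F (KInf F), IsScalarTower.algebraMap_apply F F[X] (KInf F)]; rfl
end CInf

/-! ### Completed tensor products -/

section CompletedTensor

variable {F : Type*} [Field F]

/-- For a discrete `F`-vector space `M` over a finite field `F`, the Pontryagin dual of `M` is
`Hom_F(M, F)` with the topology of pointwise convergence. -/
instance dualTopology (M : Type*) [AddCommGroup M] [Module F M] :
    TopologicalSpace (Module.Dual F M) :=
  TopologicalSpace.induced (fun g m => g m) (@Pi.topologicalSpace M (fun _ => F) fun _ => ⊥)

section
variable {M : Type*} [AddCommGroup M] [Module F M]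

lemma continuous_dual_eval {Y : Type*} [TopologicalSpace Y] (m : M) (f : F → Y) :
    Continuous fun g : Module.Dual F M => f (g m) := by
  let _ : TopologicalSpace F := ⊥
  have : DiscreteTopology F := ⟨rfl⟩
  have h : Continuous fun g : Module.Dual F M => (fun m => g m : M → F) := continuous_induced_dom
  exact (continuous_of_discreteTopology (f := f)).comp ((continuous_apply m).comp h)

lemma continuous_dual_iff {Y : Type*} [TopologicalSpace Y] (f : Y → Module.Dual F M) :
    Continuous f ↔ ∀ m, @Continuous Y F _ ⊥ fun y => f y m := by
  let _ : TopologicalSpace F := ⊥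
  rw [continuous_induced_rng, continuous_pi_iff]
  rfl

lemma continuous_dual_map {N : Type*} [AddCommGroup N] [Module F N]
    (T : Module.Dual F M → Module.Dual F N) (e : N → M) (h : ∀ g n, T g n = g (e n)) :
    Continuous T := by
  let _ : TopologicalSpace F := ⊥
  rw [continuous_dual_iff]
  intro n
  simp only [h]
  exact continuous_dual_eval (e n) id

lemma tendsto_coord {ι : Type*} (b : Module.Basis ι F M) :
    Tendsto (fun i => b.coord i) cofinite (𝓝 0) := by
  let _ : TopologicalSpace F := ⊥
  rw [nhds_induced, tendsto_comap_iff, tendsto_pi_nhds]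
  intro m
  refine tendsto_nhds_of_eventually_eq ?_
  have := (b.repr m).hasFiniteSupport
  filter_upwards [this.compl_mem_cofinite] with i hi
  simpa using hi

instance [Finite F] : CompactSpace (Module.Dual F M) := by
  let _ : TopologicalSpace F := ⊥
  have : DiscreteTopology F := ⟨rfl⟩
  have h : Topology.IsInducing fun g : Module.Dual F M => (fun m => g m : M → F) := ⟨rfl⟩
  rw [← isCompact_univ_iff, h.isCompact_iff, Set.image_univ]
  exact (LinearMap.isClosed_range_coe M F (RingHom.id F)).isCompact
end

variable [Finite F]

lemma CInf.continuous_fsmul (a : F) : Continuous fun z : CInf F => a • z := by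
  simp only [Algebra.smul_def]; fun_prop

lemma CInf.norm_fsmul_le (a : F) (z : CInf F) : ‖a • z‖ ≤ ‖z‖ := by
  by_cases ha : a = 0
  · simp [ha]
  have := Fintype.ofFinite F
  have h1 : ‖algebraMap F (CInf F) a‖ ^ (Fintype.card F - 1) = 1 := by
    rw [← norm_pow, ← map_pow, FiniteField.pow_card_sub_one_eq_one a ha]; simp
  have h2 : ‖algebraMap F (CInf F) a‖ = 1 :=
    (pow_eq_one_iff_of_nonneg (norm_nonneg _)
      (Nat.sub_ne_zero_of_lt Fintype.one_lt_card)).1 h1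
  rw [Algebra.smul_def, norm_mul, h2, one_mul]

variable (F) in
/-- `ℂ∞ ⊗̂ M`: the continuous `F`-linear maps from the Pontryagin dual of `M` to `ℂ∞`. -/
def CompletedTensor (M : Type*) [AddCommGroup M] [Module F M] :
    Submodule F (Module.Dual F M →ₗ[F] CInf F) where
  carrier := {f | Continuous f}
  add_mem' hf hg := Continuous.add hf hg
  zero_mem' := continuous_const
  smul_mem' a _ hf := (CInf.continuous_fsmul a).comp hf

namespace CompletedTensor

variable {M : Type*} [AddCommGroup M] [Module F M]

instance : CoeFun (CompletedTensor F M) fun _ => Module.Dual F M → CInf F := ⟨fun f => f.1⟩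

/-- The elementary tensor `c ⊗ m`, as the map `g ↦ g(m) c`. -/
def tmul (c : CInf F) (m : M) : CompletedTensor F M :=
  ⟨{ toFun := fun g => g m • c
     map_add' := fun g h => by simp [add_smul]
     map_smul' := fun a g => by simp [mul_smul] }, continuous_dual_eval m fun a => a • c⟩

/-- Multiplication by `c ⊗ 1`. -/
def leftMul (c : CInf F) (f : CompletedTensor F M) : CompletedTensor F M :=
  ⟨{ toFun := fun g => c * f g
     map_add' := fun g h => by simp [mul_add]
     map_smul' := fun a g => by simp }, continuous_const.mul f.2⟩

/-- Multiplication by `1 ⊗ a`, for `a ∈ F[θ]`. -/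
def rightMul [Module F[X] M] [IsScalarTower F F[X] M] (a : F[X]) (f : CompletedTensor F M) :
    CompletedTensor F M :=
  ⟨f.1 ∘ₗ LinearMap.lcomp F F (Algebra.lsmul F F M a), f.2.comp
    (continuous_dual_map _ (fun m => a • m) fun _ _ => rfl)⟩

/-- The Frobenius twist `f ↦ f^(1)`, which raises the coefficients in `ℂ∞` to the power `q`. -/
def twist (f : CompletedTensor F M) : CompletedTensor F M :=
  ⟨{ toFun := fun g => f g ^ Nat.card F
     map_add' := fun g h => by
      have := Fintype.ofFinite F
      have := map_add (FiniteField.frobeniusAlgHom F (CInf F)) (f g) (f h)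
      simpa [Nat.card_eq_fintype_card] using this
     map_smul' := fun a g => by
      have := Fintype.ofFinite F
      rw [map_smul, RingHom.id_apply, Algebra.smul_def, Algebra.smul_def, mul_pow, ← map_pow,
        Nat.card_eq_fintype_card, FiniteField.pow_card] }, f.2.pow _⟩

end CompletedTensor

lemma CInf.summable_of_bound {ι : Type*} {f : ι → CInf F} {a : ι → ℝ}
    (ha : Tendsto a cofinite (𝓝 0)) (hb : ∀ i, ‖f i‖ ≤ a i) : Summable f :=
  NonarchimedeanAddGroup.summable_of_tendsto_cofinite_zero (squeeze_zero_norm hb ha)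

/-- A nonarchimedean version of the Weierstrass test. -/
lemma CInf.continuous_tsum {ι Y : Type*} [TopologicalSpace Y] {f : ι → Y → CInf F} {a : ι → ℝ}
    (hc : ∀ i, Continuous (f i)) (ha : Tendsto a cofinite (𝓝 0)) (hb : ∀ i y, ‖f i y‖ ≤ a i) :
    Continuous fun y => ∑' i, f i y := by
  classical
  have hs : ∀ y, Summable fun i => f i y := fun y => CInf.summable_of_bound ha fun i => hb i y
  have hu : TendstoUniformly (fun (s : Finset ι) y => ∑ i ∈ s, f i y) (fun y => ∑' i, f i y)
      atTop := by
    rw [Metric.tendstoUniformly_iff]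
    intro ε hε
    have hfin : {i | ¬ a i < ε / 2}.Finite :=
      ha.eventually (gt_mem_nhds (half_pos hε))
    filter_upwards [eventually_ge_atTop hfin.toFinset] with s hs' y
    have h1 : Tendsto (fun t : Finset ι => dist (∑ i ∈ t, f i y) (∑ i ∈ s, f i y)) atTop
        (𝓝 (dist (∑' i, f i y) (∑ i ∈ s, f i y))) := (hs y).hasSum.dist tendsto_const_nhds
    refine lt_of_le_of_lt (le_of_tendsto h1 ?_) (half_lt_self hε)
    filter_upwards [eventually_ge_atTop s] with t ht
    rw [dist_eq_norm, ← Finset.sum_sdiff ht, add_sub_cancel_right]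
    refine IsUltrametricDist.norm_sum_le_of_forall_le_of_nonneg (half_pos hε).le fun i hi => ?_
    refine (hb i y).trans ?_
    by_contra hcon
    have : i ∈ hfin.toFinset := by
      simp only [Set.Finite.mem_toFinset, Set.mem_ofPred_eq]; intro h; exact hcon h.le
    exact (Finset.mem_sdiff.1 hi).2 (hs' this)
  exact hu.continuous (Eventually.of_forall fun s => by fun_prop).frequently

end CompletedTensor

/-! ### The evaluation pairing -/

section Pairing

variable {F : Type*} [Field F] {L : Type*} [AddCommGroup L] [Module F[X] L] [Module F L]
  [IsScalarTower F F[X] L]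

/-- For `l ∈ L` and `h` in the dual of `Ω`, the functional `μ ↦ h(μ(l))` on `Hom(L, Ω)`. -/
def evalDual (l : L) (h : Module.Dual F Ω[F[X]⁄F]) : Module.Dual F (L →ₗ[F[X]] Ω[F[X]⁄F]) where
  toFun μ := h (μ l)
  map_add' μ ν := by simp
  map_smul' a μ := by simp

lemma continuous_evalDual (l : L) : Continuous (evalDual (F := F) l) :=
  continuous_dual_map _ (fun μ => μ l) fun _ _ => rfl

variable [Finite F]

lemma CompletedTensor.exists_bound {M : Type*} [AddCommGroup M] [Module F M]
    (y : CompletedTensor F M) : ∃ B : ℝ, ∀ u, ‖y u‖ ≤ B := by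
  obtain ⟨B, hB⟩ := (isCompact_range y.2).isBounded.exists_norm_le
  exact ⟨B, fun u => hB _ ⟨u, rfl⟩⟩

lemma ev_tendsto (x : CompletedTensor F L) (B : ℝ) :
    Tendsto (fun i => ‖x ((Module.Basis.ofVectorSpace F L).coord i)‖ * B) cofinite (𝓝 0) := by
  have := (x.2.tendsto 0).comp (tendsto_coord (Module.Basis.ofVectorSpace F L))
  simpa using (this.norm.mul_const B)

lemma ev_bound (x : CompletedTensor F L) (y : CompletedTensor F (L →ₗ[F[X]] Ω[F[X]⁄F])) {B : ℝ}
    (hB : ∀ u, ‖y u‖ ≤ B) (i) (h : Module.Dual F Ω[F[X]⁄F]) :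
    ‖x ((Module.Basis.ofVectorSpace F L).coord i) *
        y (evalDual ((Module.Basis.ofVectorSpace F L) i) h)‖
      ≤ ‖x ((Module.Basis.ofVectorSpace F L).coord i)‖ * B := by
  rw [norm_mul]; gcongr; exact hB _

/-- The pairing `(ℂ∞ ⊗̂ L) ⊗ (ℂ∞ ⊗̂ Hom(L, Ω)) → ℂ∞ ⊗̂ Ω` which maps
`(∑ᵢ cᵢ ⊗ lᵢ) ⊗ (∑ⱼ dⱼ ⊗ μⱼ)` to `∑ᵢⱼ cᵢ dⱼ ⊗ μⱼ(lᵢ)`. Here `x = ∑ᵢ x(lᵢ*) ⊗ lᵢ` for an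
`F`-basis `(lᵢ)` of `L` with dual basis `(lᵢ*)`, and `h ∈ Ω^` takes the value
`∑ⱼ dⱼ h(μⱼ(lᵢ)) = y(μ ↦ h(μ(lᵢ)))` on the second factor. -/
def ev (x : CompletedTensor F L) (y : CompletedTensor F (L →ₗ[F[X]] Ω[F[X]⁄F])) :
    CompletedTensor F Ω[F[X]⁄F] :=
  have hs : ∀ h, Summable fun i => x ((Module.Basis.ofVectorSpace F L).coord i) *
      y (evalDual ((Module.Basis.ofVectorSpace F L) i) h) := fun h => by
    obtain ⟨B, hB⟩ := CompletedTensor.exists_bound y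
    exact CInf.summable_of_bound (ev_tendsto x B) fun i => ev_bound x y hB i h
  ⟨{ toFun := fun h => ∑' i, x ((Module.Basis.ofVectorSpace F L).coord i) *
        y (evalDual ((Module.Basis.ofVectorSpace F L) i) h)
     map_add' := fun h k => by
      rw [← (hs h).tsum_add (hs k)]
      refine tsum_congr fun i => ?_
      rw [← mul_add, ← map_add]; rfl
     map_smul' := fun a h => by
      rw [RingHom.id_apply, Algebra.smul_def, ← tsum_mul_left]
      refine tsum_congr fun i => ?_
      rw [mul_left_comm, ← Algebra.smul_def, ← map_smul]; rfl }, by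
    obtain ⟨B, hB⟩ := CompletedTensor.exists_bound y
    exact CInf.continuous_tsum
      (fun i => continuous_const.mul (y.2.comp (continuous_evalDual _)))
      (ev_tendsto x B) (ev_bound x y hB)⟩

/-- On elementary tensors, `ev((c ⊗ l) ⊗ (d ⊗ μ)) = cd ⊗ μ(l)`. -/
lemma ev_tmul (c d : CInf F) (l : L) (μ : L →ₗ[F[X]] Ω[F[X]⁄F]) :
    ev (CompletedTensor.tmul c l) (CompletedTensor.tmul d μ) =
      CompletedTensor.tmul (c * d) (μ l) := by
  refine Subtype.ext (LinearMap.ext fun h => ?_)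
  change ∑' i, (((Module.Basis.ofVectorSpace F L).coord i l) • c) * (h (μ _) • d) =
    h (μ l) • (c * d)
  set b := Module.Basis.ofVectorSpace F L
  rw [tsum_eq_sum (s := (b.repr l).support)]
  · have : ∀ i, (b.coord i l • c) * (h (μ (b i)) • d) =
        (h (μ (b.coord i l • b i))) • (c * d) := by
      intro i
      rw [← algebraMap_smul F[X] (b.coord i l) (b i), map_smul, algebraMap_smul, map_smul,
        smul_mul_smul_comm]; rfl
    simp only [this]
    rw [← Finset.sum_smul, ← map_sum, ← map_sum]
    congr 3
    exact b.linearCombination_repr l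
  · intro i hi
    have : b.coord i l = 0 := by simpa using hi
    rw [this]; simp

end Pairing
/-! ### Lattices, exponentials and Drinfeld modules -/

section Exponential

variable {F : Type*} [Field F] [Finite F]

lemma CInf.norm_prod_sub_one_le {ι : Type*} (s : Finset ι) (a : ι → CInf F) {ε : ℝ} (h0 : 0 ≤ ε)
    (h1 : ε ≤ 1) (h : ∀ i ∈ s, ‖a i‖ ≤ ε) : ‖∏ i ∈ s, (1 - a i) - 1‖ ≤ ε := by
  classical
  induction s using Finset.induction_on with
  | empty => simpa using h0
  | insert j s hj ih =>
    have ih' := ih fun i hi => h i (Finset.mem_insert_of_mem hi)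
    set P := ∏ i ∈ s, (1 - a i)
    have hP : ‖P‖ ≤ 1 := by
      have := IsUltrametricDist.norm_add_le_max (P - 1) 1
      rw [sub_add_cancel, norm_one] at this
      exact this.trans (max_le (ih'.trans h1) le_rfl)
    rw [Finset.prod_insert hj, show (1 - a j) * P - 1 = (P - 1) + (- (a j * P)) by ring]
    refine (IsUltrametricDist.norm_add_le_max _ _).trans (max_le ih' ?_)
    rw [norm_neg, norm_mul]
    calc ‖a j‖ * ‖P‖ ≤ ε * 1 :=
          mul_le_mul (h j (Finset.mem_insert_self _ _)) hP (norm_nonneg _) h0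
      _ = ε := mul_one _

lemma CInf.multipliable_one_sub {ι : Type*} {a : ι → CInf F} (ha : Tendsto a cofinite (𝓝 0)) :
    Multipliable fun i => 1 - a i := by
  classical
  have hfin : ∀ ε > 0, {i | ¬ ‖a i‖ < ε}.Finite := fun ε hε =>
    (by simpa using ha.norm : Tendsto (fun i => ‖a i‖) cofinite (𝓝 0)).eventually (gt_mem_nhds hε)
  let s₀ := (hfin 1 one_pos).toFinset
  have hout : ∀ {ε : ℝ} (hε : 0 < ε) {s t : Finset ι}, (hfin ε hε).toFinset ⊆ s →
      ∀ i ∈ t \ s, ‖a i‖ ≤ ε := fun hε s t hs i hi => by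
    by_contra hcon
    refine (Finset.mem_sdiff.1 hi).2 (hs ?_)
    simp only [Set.Finite.mem_toFinset, Set.mem_ofPred_eq]
    exact fun h => hcon h.le
  refine CompleteSpace.complete ?_
  change CauchySeq fun s : Finset ι => ∏ i ∈ s, (1 - a i)
  rw [Metric.cauchySeq_iff']
  intro ε hε
  let M : ℝ := ‖∏ i ∈ s₀, (1 - a i)‖
  have hM : 0 < M + 1 := by positivity
  let δ := min 1 (ε / (M + 1) / 2)
  have hδ : 0 < δ := lt_min one_pos (by positivity)
  refine ⟨s₀ ∪ (hfin δ hδ).toFinset, fun t ht => ?_⟩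
  set s := s₀ ∪ (hfin δ hδ).toFinset
  have hs : ‖∏ i ∈ s, (1 - a i)‖ ≤ M := by
    rw [← Finset.prod_sdiff (Finset.subset_union_left : s₀ ⊆ s), norm_mul]
    have h := CInf.norm_prod_sub_one_le (s \ s₀) a zero_le_one le_rfl
      (hout one_pos (subset_refl s₀))
    have h2 := IsUltrametricDist.norm_add_le_max (∏ i ∈ s \ s₀, (1 - a i) - 1) 1
    rw [sub_add_cancel, norm_one] at h2
    exact mul_le_of_le_one_left (norm_nonneg _) (h2.trans (max_le h le_rfl))
  have hts := CInf.norm_prod_sub_one_le (t \ s) a hδ.le (min_le_left _ _)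
    (hout hδ Finset.subset_union_right)
  rw [dist_eq_norm, ← Finset.prod_sdiff (show s ⊆ t from ht), ← sub_one_mul, norm_mul]
  calc _ ≤ δ * M := mul_le_mul hts hs (norm_nonneg _) hδ.le
    _ ≤ (ε / (M + 1) / 2) * (M + 1) :=
        mul_le_mul (min_le_right _ _) (by linarith) (norm_nonneg _) (by positivity)
    _ = ε / 2 := by field_simp
    _ < ε := half_lt_self hε

lemma eval_prod_add {K : Type*} [Field K] (W : Finset K) (h0 : (0 : K) ∈ W)
    (hsub : ∀ x ∈ W, ∀ y ∈ W, x - y ∈ W) (x y : K) :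
    ∏ w ∈ W, (x + y - w) = ∏ w ∈ W, (x - w) + ∏ w ∈ W, (y - w) := by
  have hadd : ∀ x ∈ W, ∀ y ∈ W, x + y ∈ W := fun x hx y hy => by
    simpa using hsub x hx _ (hsub 0 h0 y hy)
  let P : K[X] := ∏ w ∈ W, (X - C w)
  have hP : P.Monic := monic_prod_of_monic _ _ fun w _ => monic_X_sub_C w
  have hdeg : P.degree = W.card := by
    simp [P, degree_prod]
  have hev : ∀ z, P.eval z = ∏ w ∈ W, (z - w) := fun z => by simp [P, eval_prod]
  have key : P.comp (X + C y) = P + C (P.eval y) := by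
    refine eq_of_degree_sub_lt_of_eval_finset_eq W ?_ ?_
    · have hd : (P.comp (X + C y)).degree = P.degree := by
        rw [degree_eq_natDegree (hP.comp_X_add_C y).ne_zero, degree_eq_natDegree hP.ne_zero,
          natDegree_comp]
        simp
      have h1 : (P.comp (X + C y) - P).degree < W.card := by
        rw [← hdeg, ← hd]
        exact degree_sub_lt_left hd (hP.comp_X_add_C y).ne_zero
          ((hP.comp_X_add_C y).leadingCoeff.trans hP.leadingCoeff.symm)
      rw [← sub_sub]
      refine (degree_sub_le _ _).trans_lt (max_lt h1 (degree_C_le.trans_lt ?_))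
      exact_mod_cast Finset.card_pos.2 ⟨0, h0⟩
    · intro v hv
      have hv0 : P.eval v = 0 := by
        rw [hev]; exact Finset.prod_eq_zero hv (sub_self v)
      simp only [eval_comp, eval_add, eval_X, eval_C, hv0, zero_add]
      rw [hev, hev]
      refine Finset.prod_nbij' (· - v) (· + v) (fun w hw => hsub w hw v hv)
        (fun w hw => hadd w hw v hv) (fun w _ => by simp) (fun w _ => by simp) fun w _ => by ring
  have := congrArg (eval x) key
  simpa only [eval_comp, eval_add, eval_X, eval_C, hev] using this

/-- An `F[θ]`-lattice in `ℂ∞`: a finitely generated submodule with finitely many elements in each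
ball. -/
structure IsLattice (Λ : Submodule F[X] (CInf F)) : Prop where
  fg : Λ.FG
  finite_ball : ∀ R : ℝ, {x : CInf F | x ∈ Λ ∧ ‖x‖ ≤ R}.Finite

/-- `exp_Λ(x) = x ∏_{λ ∈ Λ ∖ {0}} (1 - x / λ)`. -/
def expLattice (Λ : Submodule F[X] (CInf F)) (x : CInf F) : CInf F :=
  x * ∏' l : {l : Λ // l ≠ 0}, (1 - x / ((l : Λ) : CInf F))

namespace IsLattice

variable {Λ : Submodule F[X] (CInf F)}

lemma tendsto_div (hΛ : IsLattice Λ) (x : CInf F) :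
    Tendsto (fun l : {l : Λ // l ≠ 0} => x / ((l : Λ) : CInf F)) cofinite (𝓝 0) := by
  rw [Metric.tendsto_nhds]
  intro ε hε
  have hinj : Function.Injective fun l : {l : Λ // l ≠ 0} => ((l : Λ) : CInf F) :=
    Subtype.val_injective.comp Subtype.val_injective
  refine ((hΛ.finite_ball (‖x‖ / ε)).preimage hinj.injOn).subset fun l hl => ?_
  refine ⟨l.1.2, ?_⟩
  have hl0 : 0 < ‖((l : Λ) : CInf F)‖ := norm_pos_iff.2 fun h => l.2 (Subtype.ext h)
  replace hl : ¬ dist (x / ((l : Λ) : CInf F)) 0 < ε := hl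
  rw [dist_zero_right, norm_div, not_lt, le_div_iff₀ hl0] at hl
  rw [le_div_iff₀ hε]
  linarith

open Classical in
/-- The nonzero elements of norm at most `n`. -/
def ballFinset (hΛ : IsLattice Λ) (n : ℕ) : Finset {l : Λ // l ≠ 0} :=
  ((hΛ.finite_ball n).preimage (f := fun l : {l : Λ // l ≠ 0} => ((l : Λ) : CInf F))
    (Subtype.val_injective.comp Subtype.val_injective).injOn).toFinset

lemma mem_ballFinset (hΛ : IsLattice Λ) (n : ℕ) (l : {l : Λ // l ≠ 0}) :
    l ∈ hΛ.ballFinset n ↔ ‖((l : Λ) : CInf F)‖ ≤ n := by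
  simp [ballFinset]

lemma tendsto_ballFinset (hΛ : IsLattice Λ) : Tendsto hΛ.ballFinset atTop atTop := by
  refine tendsto_atTop_finset_of_monotone (fun m n hmn l hl => ?_) fun l => ?_
  · rw [mem_ballFinset] at hl ⊢
    exact hl.trans (by exact_mod_cast hmn)
  · obtain ⟨n, hn⟩ := exists_nat_ge ‖((l : Λ) : CInf F)‖
    exact ⟨n, (hΛ.mem_ballFinset n l).2 hn⟩

lemma tendsto_exp (hΛ : IsLattice Λ) (x : CInf F) :
    Tendsto (fun n => x * ∏ l ∈ hΛ.ballFinset n, (1 - x / ((l : Λ) : CInf F))) atTop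
      (𝓝 (expLattice Λ x)) :=
  ((CInf.multipliable_one_sub (hΛ.tendsto_div x)).hasProd.comp hΛ.tendsto_ballFinset).const_mul x

lemma partial_eq (hΛ : IsLattice Λ) (n : ℕ) (x : CInf F) :
    x * ∏ l ∈ hΛ.ballFinset n, (1 - x / ((l : Λ) : CInf F)) =
      (∏ w ∈ (hΛ.finite_ball n).toFinset, (x - w)) *
        ∏ l ∈ hΛ.ballFinset n, (-((l : Λ) : CInf F))⁻¹ := by
  classical
  have h0 : (0 : CInf F) ∈ (hΛ.finite_ball n).toFinset := by simp
  have hne : ∀ l : {l : Λ // l ≠ 0}, ((l : Λ) : CInf F) ≠ 0 := fun l h => l.2 (Subtype.ext h)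
  rw [← Finset.mul_prod_erase _ _ h0, sub_zero, mul_assoc]
  congr 1
  have : ∏ w ∈ (hΛ.finite_ball n).toFinset.erase 0, (x - w) =
      ∏ l ∈ hΛ.ballFinset n, (x - ((l : Λ) : CInf F)) := by
    symm
    refine Finset.prod_bij (fun l _ => ((l : Λ) : CInf F)) ?_ ?_ ?_ ?_
    · intro l hl
      simp only [Finset.mem_erase, Set.Finite.mem_toFinset, Set.mem_ofPred_eq]
      exact ⟨hne l, l.1.2, (hΛ.mem_ballFinset n l).1 hl⟩
    · intro l _ m _ h
      exact Subtype.ext (Subtype.ext h)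
    · intro w hw
      simp only [Finset.mem_erase, Set.Finite.mem_toFinset, Set.mem_ofPred_eq] at hw
      exact ⟨⟨⟨w, hw.2.1⟩, fun h => hw.1 (congrArg Subtype.val h)⟩,
        (hΛ.mem_ballFinset n _).2 hw.2.2, rfl⟩
    · intros; rfl
  rw [this, ← Finset.prod_mul_distrib]
  refine Finset.prod_congr rfl fun l _ => ?_
  have := hne l
  field_simp
  ring

lemma exp_add (hΛ : IsLattice Λ) (x y : CInf F) :
    expLattice Λ (x + y) = expLattice Λ x + expLattice Λ y := by
  refine tendsto_nhds_unique (hΛ.tendsto_exp (x + y)) ?_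
  refine ((hΛ.tendsto_exp x).add (hΛ.tendsto_exp y)).congr fun n => ?_
  rw [partial_eq, partial_eq, partial_eq, ← add_mul, eval_prod_add]
  · simp
  · intro x hx y hy
    simp only [Set.Finite.mem_toFinset, Set.mem_ofPred_eq] at hx hy ⊢
    refine ⟨Λ.sub_mem hx.1 hy.1, ?_⟩
    have := IsUltrametricDist.norm_add_le_max x (-y)
    rw [← sub_eq_add_neg, norm_neg] at this
    exact this.trans (max_le hx.2 hy.2)

lemma exp_smul (a : F) (x : CInf F) :
    expLattice Λ (a • x) = a • expLattice Λ x := by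
  by_cases ha : a = 0
  · simp [ha, expLattice]
  have ha' : (C a : F[X]) ≠ 0 := by simpa using ha
  have hC : ∀ z : CInf F, (C a : F[X]) • z = a • z := fun z => by
    rw [← algebraMap_smul F[X] a z]; rfl
  have hmul : a⁻¹ * a = 1 := inv_mul_cancel₀ ha
  let e : {l : Λ // l ≠ 0} ≃ {l : Λ // l ≠ 0} :=
    { toFun := fun l => ⟨a • l.1, fun h => l.2 (by
        have := congrArg (fun z => a⁻¹ • z) h
        simpa [smul_smul, hmul] using this)⟩
      invFun := fun l => ⟨a⁻¹ • l.1, fun h => l.2 (by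
        have := congrArg (fun z => a • z) h
        simpa [smul_smul, mul_inv_cancel₀ ha] using this)⟩
      left_inv := fun l => by ext; simp [smul_smul, hmul]
      right_inv := fun l => by ext; simp [smul_smul, mul_inv_cancel₀ ha] }
  rw [expLattice, expLattice, ← e.tprod_eq, smul_mul_assoc]
  congr 2
  refine tprod_congr fun l => ?_
  have : algebraMap F (CInf F) a ≠ 0 := by simpa using ha
  have hl : (((e l : {l : Λ // l ≠ 0}) : Λ) : CInf F) = a • ((l : Λ) : CInf F) := rfl
  rw [hl, Algebra.smul_def, Algebra.smul_def, mul_div_mul_left _ _ this]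

lemma exp_eq_zero (hΛ : IsLattice Λ) (l : Λ) : expLattice Λ (l : CInf F) = 0 := by
  by_cases h : l = 0
  · simp [h, expLattice]
  have hne : (l : CInf F) ≠ 0 := fun h' => h (Subtype.ext h')
  refine tendsto_nhds_unique (hΛ.tendsto_exp _) (tendsto_nhds_of_eventually_eq ?_)
  obtain ⟨n, hn⟩ := exists_nat_ge ‖(l : CInf F)‖
  filter_upwards [eventually_ge_atTop n] with m hm
  have hmem : (⟨l, h⟩ : {l : Λ // l ≠ 0}) ∈ hΛ.ballFinset m :=
    (hΛ.mem_ballFinset _ _).2 (hn.trans (by exact_mod_cast hm))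
  rw [Finset.prod_eq_zero hmem (by simp [hne]), mul_zero]

/-- `exp_Λ` as an `F`-linear map. -/
def expLinear (hΛ : IsLattice Λ) : CInf F →ₗ[F] CInf F where
  toFun := expLattice Λ
  map_add' := hΛ.exp_add
  map_smul' := exp_smul

lemma continuous_exp (hΛ : IsLattice Λ) : Continuous (expLattice Λ) := by
  refine continuous_of_continuousAt_zero hΛ.expLinear.toAddMonoidHom ?_
  change ContinuousAt (expLattice Λ) 0
  have h0 : expLattice Λ 0 = 0 := by simp [expLattice]
  have hinj : Function.Injective fun l : {l : Λ // l ≠ 0} => ((l : Λ) : CInf F) :=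
    Subtype.val_injective.comp Subtype.val_injective
  rw [ContinuousAt, h0]
  have hδ : ∃ δ > 0, ∀ l : {l : Λ // l ≠ 0}, δ ≤ ‖((l : Λ) : CInf F)‖ := by
    have hne : ∀ l : {l : Λ // l ≠ 0}, 0 < ‖((l : Λ) : CInf F)‖ :=
      fun l => norm_pos_iff.2 fun h => l.2 (Subtype.ext h)
    rcases (hΛ.ballFinset 1).eq_empty_or_nonempty with he | he
    · refine ⟨1, one_pos, fun l => ?_⟩
      by_contra hl
      have : l ∈ hΛ.ballFinset 1 := (hΛ.mem_ballFinset _ _).2 (by simpa using (not_le.1 hl).le)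
      simp [he] at this
    · obtain ⟨m, hm, hmin⟩ := (hΛ.ballFinset 1).exists_min_image
        (fun l => ‖((l : Λ) : CInf F)‖) he
      refine ⟨_, hne m, fun l => ?_⟩
      by_cases hl : l ∈ hΛ.ballFinset 1
      · exact hmin l hl
      · rw [mem_ballFinset] at hl hm
        exact hm.trans (not_le.1 hl).le
  obtain ⟨δ, hδ, hle⟩ := hδ
  refine squeeze_zero_norm' (a := fun x => ‖x‖) ?_ (by simpa using tendsto_norm_zero)
  filter_upwards [Metric.ball_mem_nhds (0 : CInf F) hδ] with x hx
  rw [mem_ball_zero_iff] at hx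
  refine le_of_tendsto (hΛ.tendsto_exp x).norm (Eventually.of_forall fun n => ?_)
  rw [norm_mul]
  refine mul_le_of_le_one_right (norm_nonneg _) ?_
  have h := CInf.norm_prod_sub_one_le (hΛ.ballFinset n)
    (fun l => x / ((l : Λ) : CInf F)) zero_le_one le_rfl fun l _ => by
      rw [norm_div]
      exact div_le_one_of_le₀ (hx.le.trans (hle l)) (norm_nonneg _)
  have h2 := IsUltrametricDist.norm_add_le_max
    (∏ l ∈ hΛ.ballFinset n, (1 - x / ((l : Λ) : CInf F)) - 1) 1
  rw [sub_add_cancel, norm_one] at h2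
  exact h2.trans (max_le h le_rfl)

end IsLattice

end Exponential

section Universal

variable {F : Type*} [Field F]

namespace KInf

/-- The coefficient of `θ^(-n)`. -/
def coeff (n : ℤ) : KInf F →ₗ[F] F where
  toFun b := HahnSeries.coeff (b : LaurentSeries F) n
  map_add' _ _ := HahnSeries.coeff_add
  map_smul' a b := congrArg (fun c : LaurentSeries F => HahnSeries.coeff c n)
    (HahnSeries.C_mul_eq_smul (Γ := ℤ) (r := a) (x := (b : LaurentSeries F)))

lemma ext_coeff {b c : KInf F} (h : ∀ n, coeff n b = coeff n c) : b = c :=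
  HahnSeries.ext (_root_.funext h)

/-- The monomial `θ^(-n)`. -/
def mono (n : ℤ) : KInf F := (HahnSeries.single n (1 : F) : LaurentSeries F)

lemma coeff_mono (m n : ℤ) : coeff m (mono (F := F) n) = if m = n then 1 else 0 := by
  classical
  exact HahnSeries.coeff_single.trans (by congr)

lemma mono_mul (m n : ℤ) : mono (F := F) m * mono n = mono (m + n) := by
  have := HahnSeries.single_mul_single (a := m) (b := n) (r := (1 : F)) (s := (1 : F))
  rw [mul_one] at this
  exact this

lemma mono_zero : mono (F := F) 0 = 1 := rfl

lemma theta_pow (k : ℕ) : theta F ^ k = mono (-(k : ℤ)) := by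
  induction k with
  | zero => simp [mono_zero]
  | succ k ih =>
    rw [pow_succ, ih, show theta F = mono (-1) from rfl, mono_mul]
    congr 1; push_cast; ring

lemma coeff_mul_theta_pow (b : KInf F) (n : ℤ) (k : ℕ) :
    coeff n (b * theta F ^ k) = coeff (n + k) b := by
  rw [theta_pow]
  have := HahnSeries.coeff_mul_single_add (x := (b : LaurentSeries F)) (r := (1 : F))
    (a := n + k) (b := -(k : ℤ))
  rw [add_neg_cancel_right, mul_one] at this
  exact this

lemma theta_inv_pow (k : ℕ) : (theta F)⁻¹ ^ k = mono (k : ℤ) := by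
  rw [inv_pow]
  refine inv_eq_of_mul_eq_one_right ?_
  rw [theta_pow, mono_mul, neg_add_cancel, mono_zero]

lemma coeff_theta_inv_pow (n : ℤ) (k : ℕ) :
    coeff n ((theta F)⁻¹ ^ k) = if n = k then 1 else 0 := by
  rw [theta_inv_pow, coeff_mono]

lemma coeff_theta_pow (n : ℤ) (k : ℕ) :
    coeff n (theta F ^ k) = if n = -(k : ℤ) then 1 else 0 := by
  rw [theta_pow, coeff_mono]

lemma coeff_algebraMap (a : F[X]) (k : ℕ) :
    coeff (-(k : ℤ)) (algebraMap F[X] (KInf F) a) = a.coeff k := by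
  change coeff (-(k : ℤ)) (aeval (theta F) a) = _
  rw [aeval_eq_sum_range, map_sum]
  simp only [map_smul, coeff_theta_pow, smul_eq_mul, mul_ite, mul_one, mul_zero, neg_inj,
    Nat.cast_inj]
  rw [Finset.sum_ite_eq]
  split_ifs with h
  · rfl
  · exact (coeff_eq_zero_of_natDegree_lt (by simpa using h)).symm

lemma algebraMap_injective : Function.Injective (algebraMap F[X] (KInf F)) := fun a b h => by
  ext k
  rw [← coeff_algebraMap, h, coeff_algebraMap]

lemma algebraMap_X : algebraMap F[X] (KInf F) X = theta F := aeval_X (theta F)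

variable [Finite F]

lemma norm_le_theta_inv_pow {f : KInf F} {k : ℕ} (h : ∀ n : ℤ, n < k → coeff n f = 0) :
    ‖f‖ ≤ ‖(theta F)⁻¹ ^ k‖ := by
  refine Valued.toNormedField.norm_le_iff.2 ?_
  have h1 : Valued.v ((theta F)⁻¹ ^ k) = WithZero.exp (-(k : ℤ)) := by
    rw [theta_inv_pow]; exact LaurentSeries.valuation_single_zpow F k
  rw [h1]
  exact (LaurentSeries.valuation_le_iff_coeff_lt_eq_zero F).2 h

lemma norm_theta_inv_lt_one : ‖(theta F)⁻¹‖ < 1 := by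
  rw [norm_inv, norm_theta]
  exact inv_lt_one_of_one_lt₀ (by exact_mod_cast Finite.one_lt_card)

lemma norm_fsmul_le (a : F) (b : KInf F) : ‖a • b‖ ≤ ‖b‖ := by
  refine Valued.toNormedField.norm_le_iff.2 ?_
  by_cases hb : b = 0
  · simp [hb]
  have hb' : Valued.v b ≠ 0 := (Valuation.ne_zero_iff _).2 hb
  refine (LaurentSeries.valuation_le_iff_coeff_lt_log_eq_zero F hb').2 fun n hn => ?_
  have := (LaurentSeries.valuation_le_iff_coeff_lt_log_eq_zero F hb').1 le_rfl n hn
  change coeff n (a • b) = 0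
  rw [map_smul]
  change a • HahnSeries.coeff (b : LaurentSeries F) n = 0
  erw [this, smul_zero]

/-- Every element of `K∞` is the sum of a polynomial and of a series in `θ⁻¹`
without constant term. -/
lemma exists_hasSum (f : KInf F) : ∃ a : F[X],
    HasSum (fun j : ℕ => coeff (j + 1) f • (theta F)⁻¹ ^ (j + 1)) (f - algebraMap F[X] _ a) := by
  obtain ⟨N, hN⟩ : ∃ N : ℕ, ∀ n : ℤ, n < -(N : ℤ) → coeff n f = 0 := by
    refine ⟨(-HahnSeries.order (f : LaurentSeries F)).toNat, fun n hn => ?_⟩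
    exact HahnSeries.coeff_eq_zero_of_lt_order (by omega)
  let a : F[X] := ∑ k ∈ Finset.range (N + 1), coeff (-(k : ℤ)) f • X ^ k
  have ha : algebraMap F[X] (KInf F) a =
      ∑ k ∈ Finset.range (N + 1), coeff (-(k : ℤ)) f • theta F ^ k := by
    change aeval (theta F) a = _
    simp [a]
  have hca : ∀ n : ℤ, coeff n (algebraMap F[X] (KInf F) a) = if n ≤ 0 then coeff n f else 0 := by
    intro n
    rw [ha, map_sum]
    simp only [map_smul, coeff_theta_pow, smul_eq_mul, mul_ite, mul_one, mul_zero]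
    split_ifs with hn
    · by_cases hn' : n < -(N : ℤ)
      · rw [hN n hn']
        refine Finset.sum_eq_zero fun k hk => ?_
        rw [Finset.mem_range] at hk
        rw [if_neg (by omega)]
      · rw [Finset.sum_eq_single (-n).toNat]
        · have : -(((-n).toNat : ℕ) : ℤ) = n := by omega
          rw [this, if_pos rfl]
        · intro k _ hk
          rw [if_neg (by omega)]
        · intro hk
          rw [Finset.mem_range] at hk
          omega
    · exact Finset.sum_eq_zero fun k _ => if_neg (by omega)
  refine ⟨a, ?_⟩
  have hpow : Tendsto (fun j : ℕ => ‖(theta F)⁻¹ ^ (j + 1)‖) atTop (𝓝 0) := by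
    simp only [norm_pow]
    exact (tendsto_pow_atTop_nhds_zero_of_lt_one (norm_nonneg _) norm_theta_inv_lt_one).comp
      (tendsto_add_atTop_nat 1)
  have hs : Summable fun j : ℕ => coeff (j + 1) f • (theta F)⁻¹ ^ (j + 1) := by
    refine NonarchimedeanAddGroup.summable_of_tendsto_cofinite_zero ?_
    rw [Nat.cofinite_eq_atTop]
    exact squeeze_zero_norm (fun j => norm_fsmul_le _ _) hpow
  have hlim : Tendsto (fun n => ∑ j ∈ Finset.range n, coeff (j + 1) f • (theta F)⁻¹ ^ (j + 1))
      atTop (𝓝 (f - algebraMap F[X] _ a)) := by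
    rw [tendsto_iff_norm_sub_tendsto_zero]
    refine squeeze_zero (fun _ => norm_nonneg _) (fun n => ?_) hpow
    rw [norm_sub_rev]
    refine norm_le_theta_inv_pow fun m hm => ?_
    rw [map_sub, map_sub, hca, map_sum]
    simp only [map_smul, coeff_theta_inv_pow, smul_eq_mul, mul_ite, mul_one, mul_zero]
    push_cast at hm ⊢
    split_ifs with hm0
    · rw [Finset.sum_eq_zero fun k _ => if_neg (by omega)]; simp
    · rw [Finset.sum_eq_single (m - 1).toNat]
      · have : (((m - 1).toNat : ℕ) : ℤ) + 1 = m := by omega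
        rw [this, if_pos rfl]; simp
      · intro k _ hk
        rw [if_neg (by omega)]
      · intro hk
        rw [Finset.mem_range] at hk
        omega
  rw [← tendsto_nhds_unique hs.hasSum.tendsto_sum_nat hlim]
  exact hs.hasSum

end KInf

variable [Finite F] {Λ : Submodule F[X] (CInf F)}

/-- The functional on `Hom(Λ, Ω)` attached to `b ⊗ l ∈ K∞ ⊗ Λ` by the residue pairing: it maps `μ`
to the residue of `b μ(l)`. The residue of `f dθ` is the coefficient of `θ⁻¹` in `f`. -/
def resDual (b : KInf F) (l : Λ) : Module.Dual F (Λ →ₗ[F[X]] Ω[F[X]⁄F]) where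
  toFun μ := KInf.coeff 1 (b * algebraMap F[X] (KInf F) (KaehlerDifferential.polynomialEquiv F (μ l)))
  map_add' μ ν := by simp [mul_add]
  map_smul' a μ := by
    have : KaehlerDifferential.polynomialEquiv F ((a • μ) l) =
        a • KaehlerDifferential.polynomialEquiv F (μ l) := by
      rw [LinearMap.smul_apply, ← algebraMap_smul F[X] a (μ l), map_smul, algebraMap_smul]
    rw [this, Algebra.smul_def a, map_mul (algebraMap F[X] (KInf F)), ← IsScalarTower.algebraMap_apply F F[X] (KInf F),
      mul_left_comm, ← Algebra.smul_def, map_smul, RingHom.id_apply]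

lemma resDual_apply (b : KInf F) (l : Λ) (μ : Λ →ₗ[F[X]] Ω[F[X]⁄F]) :
    resDual b l μ = KInf.coeff 1
      (b * algebraMap F[X] (KInf F) (KaehlerDifferential.polynomialEquiv F (μ l))) := rfl

/-- `ω ∈ ℂ∞ ⊗̂ Hom(Λ, Ω)` is the universal special function: as a function on the Pontryagin dual
`K∞ ⊗ Λ / Λ` of `Hom(Λ, Ω)`, it is induced by `exp_Λ : K∞Λ → ℂ∞`. -/
def IsUniversalSpecialFunction (Λ : Submodule F[X] (CInf F))
    (ω : CompletedTensor F (Λ →ₗ[F[X]] Ω[F[X]⁄F])) : Prop :=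
  ∀ (b : KInf F) (l : Λ), ω (resDual b l) = expLattice Λ (b • (l : CInf F))

namespace IsLattice

lemma free (hΛ : IsLattice Λ) : Module.Finite F[X] Λ ∧ Module.Free F[X] Λ := by
  have : Module.Finite F[X] Λ := Module.Finite.iff_fg.2 hΛ.fg
  have hinj : Function.Injective (algebraMap F[X] (CInf F)) :=
    (algebraMap (KInf F) (CInf F)).injective.comp KInf.algebraMap_injective
  have : IsDomain F[X] := inferInstance
  have : FaithfulSMul F[X] (CInf F) := (faithfulSMul_iff_algebraMap_injective _ _).2 hinj
  have : Module.IsTorsionFree F[X] (CInf F) := inferInstance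
  have : Module.IsTorsionFree F[X] Λ := inferInstance
  exact ⟨‹_›, inferInstance⟩

/-- The homomorphism `l ↦ p πᵢ*(l) dθ`, for an `F[θ]`-basis `(πᵢ)` of `Λ`. -/
def basisHom {ι : Type*} (π : Module.Basis ι F[X] Λ) (i : ι) (p : F[X]) :
    Λ →ₗ[F[X]] Ω[F[X]⁄F] :=
  (p • π.coord i).smulRight (KaehlerDifferential.D F F[X] X)

lemma polynomialEquiv_smul_D (p : F[X]) :
    KaehlerDifferential.polynomialEquiv F (p • KaehlerDifferential.D F F[X] X) = p := by
  simp

lemma resDual_basisHom {ι : Type*} (π : Module.Basis ι F[X] Λ) (i : ι) (b : KInf F) (l : Λ)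
    (j : ℕ) : resDual b l (basisHom π i (X ^ j)) =
      KInf.coeff (j + 1) (b * algebraMap F[X] (KInf F) (π.coord i l)) := by
  have h : basisHom π i (X ^ j) l =
      (X ^ j * π.coord i l) • KaehlerDifferential.D F F[X] X := rfl
  rw [resDual_apply, h, polynomialEquiv_smul_D, map_mul (algebraMap F[X] (KInf F)),
    map_pow (algebraMap F[X] (KInf F)), KInf.algebraMap_X, mul_left_comm, mul_comm,
    KInf.coeff_mul_theta_pow, add_comm]

lemma theta_pow_tendsto :
    Tendsto (fun j : ℕ => ‖algebraMap (KInf F) (CInf F) ((KInf.theta F)⁻¹ ^ (j + 1))‖)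
      cofinite (𝓝 0) := by
  rw [Nat.cofinite_eq_atTop]
  simp only [norm_algebraMap', norm_pow]
  exact (tendsto_pow_atTop_nhds_zero_of_lt_one (norm_nonneg _) KInf.norm_theta_inv_lt_one).comp
      (tendsto_add_atTop_nat 1)

/-- The `K∞`-coordinate at `πᵢ` of a representative in `K∞Λ` of a functional on `Hom(Λ, Ω)`. -/
def coordMap {ι : Type*} (π : Module.Basis ι F[X] Λ) (i : ι) :
    Module.Dual F (Λ →ₗ[F[X]] Ω[F[X]⁄F]) →ₗ[F] CInf F :=
  have hs : ∀ u : Module.Dual F (Λ →ₗ[F[X]] Ω[F[X]⁄F]), Summable fun j : ℕ =>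
      u (basisHom π i (X ^ j)) • algebraMap (KInf F) (CInf F) ((KInf.theta F)⁻¹ ^ (j + 1)) :=
    fun u => CInf.summable_of_bound theta_pow_tendsto fun j => CInf.norm_fsmul_le _ _
  { toFun := fun u => ∑' j : ℕ,
      u (basisHom π i (X ^ j)) • algebraMap (KInf F) (CInf F) ((KInf.theta F)⁻¹ ^ (j + 1))
    map_add' := fun u v => by
      rw [← (hs u).tsum_add (hs v)]
      exact tsum_congr fun j => by rw [LinearMap.add_apply, add_smul]
    map_smul' := fun a u => by
      rw [RingHom.id_apply, Algebra.smul_def, ← tsum_mul_left]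
      exact tsum_congr fun j => by
        rw [← Algebra.smul_def, smul_smul, LinearMap.smul_apply, smul_eq_mul] }

lemma continuous_coordMap {ι : Type*} (π : Module.Basis ι F[X] Λ) (i : ι) :
    Continuous (coordMap π i) :=
  CInf.continuous_tsum (fun j => continuous_dual_eval (basisHom π i (X ^ j))
    fun a => a • algebraMap (KInf F) (CInf F) ((KInf.theta F)⁻¹ ^ (j + 1)))
    theta_pow_tendsto fun _ _ => CInf.norm_fsmul_le _ _

lemma coordMap_resDual {ι : Type*} (π : Module.Basis ι F[X] Λ) (i : ι) (b : KInf F) (l : Λ) :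
    ∃ a : F[X], coordMap π i (resDual b l) =
      algebraMap (KInf F) (CInf F) (b * algebraMap F[X] (KInf F) (π.coord i l)) -
        algebraMap F[X] (CInf F) a := by
  obtain ⟨a, ha⟩ := KInf.exists_hasSum (b * algebraMap F[X] (KInf F) (π.coord i l))
  refine ⟨a, ?_⟩
  have h := ha.map (algebraMap (KInf F) (CInf F)) (algebraMapCLM (KInf F) (CInf F)).continuous
  rw [map_sub] at h
  refine Eq.trans ?_ h.tsum_eq
  refine tsum_congr fun j => ?_
  rw [resDual_basisHom, Function.comp_apply, Algebra.smul_def, Algebra.smul_def,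
    map_mul (algebraMap (KInf F) (CInf F)), ← IsScalarTower.algebraMap_apply]

lemma exists_universal (hΛ : IsLattice Λ) : ∃ ω, IsUniversalSpecialFunction Λ ω := by
  obtain ⟨_, _⟩ := hΛ.free
  let π := Module.Free.chooseBasis F[X] Λ
  let T : Module.Dual F (Λ →ₗ[F[X]] Ω[F[X]⁄F]) →ₗ[F] CInf F :=
    ∑ i, LinearMap.mulRight F ((π i : Λ) : CInf F) ∘ₗ coordMap π i
  have hT : ∀ u, T u = ∑ i, coordMap π i u * ((π i : Λ) : CInf F) := fun u => by simp [T]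
  refine ⟨⟨hΛ.expLinear ∘ₗ T, hΛ.continuous_exp.comp ?_⟩, fun b l => ?_⟩
  · rw [show (T : _ → CInf F) = _ from _root_.funext hT]
    exact continuous_finsetSum _ fun i _ => (continuous_coordMap π i).mul continuous_const
  · choose a ha using fun i => coordMap_resDual π i b l
    have hl : (l : CInf F) = ∑ i, algebraMap F[X] (CInf F) (π.coord i l) * ((π i : Λ) : CInf F) := by
      have h := congrArg (Subtype.val : Λ → CInf F) (π.sum_repr l)
      rw [AddSubmonoidClass.coe_finsetSum] at h
      rw [← h]
      refine Finset.sum_congr rfl fun i _ => ?_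
      rw [Submodule.coe_smul, Algebra.smul_def, Module.Basis.coord_apply]
    have hTl : T (resDual b l) = b • (l : CInf F) + -((∑ i, a i • π i : Λ) : CInf F) := by
      rw [hT, hl, Finset.smul_sum, ← sub_eq_add_neg, AddSubmonoidClass.coe_finsetSum,
        ← Finset.sum_sub_distrib]
      refine Finset.sum_congr rfl fun i _ => ?_
      rw [ha, map_mul, Submodule.coe_smul, Algebra.smul_def (a i), Algebra.smul_def b, sub_mul,
        mul_assoc, ← IsScalarTower.algebraMap_apply F[X] (KInf F) (CInf F)]
    change expLattice Λ (T (resDual b l)) = _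
    rw [hTl, hΛ.exp_add, ← Submodule.coe_neg, hΛ.exp_eq_zero, add_zero]

lemma exists_eq_sum_resDual {ι : Type*} [Fintype ι] (π : Module.Basis ι F[X] Λ)
    (u : Module.Dual F (Λ →ₗ[F[X]] Ω[F[X]⁄F])) : ∃ b : ι → KInf F, u = ∑ i, resDual (b i) (π i) := by
  classical
  let b : ι → KInf F := fun i => (HahnSeries.ofPowerSeries ℤ F (PowerSeries.mk fun n =>
    u (basisHom π i (X ^ (n - 1)))) : LaurentSeries F)
  have hb : ∀ i (j : ℕ), KInf.coeff (1 + j) (b i) = u (basisHom π i (X ^ j)) := by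
    intro i j
    have : ((1 : ℤ) + j) = ((j + 1 : ℕ) : ℤ) := by push_cast; ring
    rw [this]
    refine (HahnSeries.ofPowerSeries_apply_coeff (Γ := ℤ) _ (j + 1)).trans ?_
    simp
  refine ⟨b, LinearMap.ext fun μ => ?_⟩
  have key : ∀ i (p : F[X]), u (basisHom π i p) =
      KInf.coeff 1 (b i * algebraMap F[X] (KInf F) p) := by
    intro i p
    induction p using Polynomial.induction_on' with
    | add p q hp hq =>
      have : basisHom π i (p + q) = basisHom π i p + basisHom π i q := by
        ext; simp [basisHom, add_smul]
      rw [this, map_add, hp, hq, map_add (algebraMap F[X] (KInf F)), mul_add, map_add]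
    | monomial n a =>
      have h1 : basisHom π i (monomial n a) = a • basisHom π i (X ^ n) := by
        refine LinearMap.ext fun l => ?_
        simp only [basisHom, LinearMap.smul_apply, LinearMap.smulRight_apply, smul_eq_mul]
        rw [← C_mul_X_pow_eq_monomial, mul_assoc, mul_smul, ← algebraMap_smul F[X] a]; rfl
      rw [h1, map_smul, ← hb, ← C_mul_X_pow_eq_monomial, map_mul (algebraMap F[X] (KInf F)),
        map_pow (algebraMap F[X] (KInf F)), KInf.algebraMap_X, mul_left_comm,
        show algebraMap F[X] (KInf F) (C a) = algebraMap F (KInf F) a from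
          (IsScalarTower.algebraMap_apply F F[X] (KInf F) a).symm,
        ← Algebra.smul_def, map_smul, KInf.coeff_mul_theta_pow]
  have hμ : μ = ∑ i, basisHom π i (KaehlerDifferential.polynomialEquiv F (μ (π i))) := by
    refine π.ext fun k => ?_
    rw [LinearMap.sum_apply, Finset.sum_eq_single k]
    · apply (KaehlerDifferential.polynomialEquiv F).injective
      simp [basisHom]
    · intro i _ hi
      simp [basisHom, hi.symm]
    · simp
  conv_lhs => rw [hμ]
  rw [map_sum, LinearMap.sum_apply]
  exact Finset.sum_congr rfl fun i _ => key i _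

theorem existsUnique_universal (hΛ : IsLattice Λ) :
    ∃! ω, IsUniversalSpecialFunction Λ ω := by
  obtain ⟨_, _⟩ := hΛ.free
  obtain ⟨ω, hω⟩ := hΛ.exists_universal
  refine ⟨ω, hω, fun ω' hω' => Subtype.ext (LinearMap.ext fun u => ?_)⟩
  obtain ⟨b, rfl⟩ := exists_eq_sum_resDual (Module.Free.chooseBasis F[X] Λ) u
  rw [map_sum, map_sum]
  exact Finset.sum_congr rfl fun i _ => (hω' _ _).trans (hω _ _).symm

/-- The universal special function `ω ∈ ℂ∞ ⊗̂ Hom(Λ, Ω)`. -/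
def omega (hΛ : IsLattice Λ) : CompletedTensor F (Λ →ₗ[F[X]] Ω[F[X]⁄F]) :=
  hΛ.existsUnique_universal.choose

lemma tendsto_norm_inv (hΛ : IsLattice Λ) :
    Tendsto (fun l : {l : Λ // l ≠ 0} => ‖((l : Λ) : CInf F)⁻¹‖) cofinite (𝓝 0) := by
  simpa using (hΛ.tendsto_div 1).norm

/-- The universal dual special function `ζ = -∑_{λ ∈ Λ ∖ {0}} λ⁻¹ ⊗ λ ∈ ℂ∞ ⊗̂ Λ`, as the map
`g ↦ -∑ g(λ) λ⁻¹` on the Pontryagin dual of `Λ`. -/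
def zeta (hΛ : IsLattice Λ) : CompletedTensor F Λ :=
  have hs : ∀ g : Module.Dual F Λ, Summable fun l : {l : Λ // l ≠ 0} =>
      g l • ((l : Λ) : CInf F)⁻¹ :=
    fun g => CInf.summable_of_bound hΛ.tendsto_norm_inv fun l => CInf.norm_fsmul_le _ _
  ⟨{ toFun := fun g => -∑' l : {l : Λ // l ≠ 0}, g l • ((l : Λ) : CInf F)⁻¹
     map_add' := fun g h => by
      rw [← neg_add, ← (hs g).tsum_add (hs h)]
      exact congrArg _ (tsum_congr fun l => by rw [LinearMap.add_apply, add_smul])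
     map_smul' := fun a g => by
      rw [RingHom.id_apply, smul_neg, Algebra.smul_def, ← tsum_mul_left]
      exact congrArg _ (tsum_congr fun l => by
        rw [← Algebra.smul_def, smul_smul, LinearMap.smul_apply, smul_eq_mul]) },
    (CInf.continuous_tsum (fun l : {l : Λ // l ≠ 0} =>
      continuous_dual_eval l.1 fun a => a • ((l : Λ) : CInf F)⁻¹)
      hΛ.tendsto_norm_inv fun _ _ => CInf.norm_fsmul_le _ _).neg⟩

end IsLattice

variable (F) in
/-- A Drinfeld `F[θ]`-module of rank `r` over `ℂ∞`: a ring homomorphism `a ↦ φ_a` from `F[θ]` to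
`ℂ∞[τ] ⊆ End_F(ℂ∞)` such that `φ_a` has degree `r deg a` in `τ` and constant term `a`. -/
structure DrinfeldModule (r : ℕ) where
  toRingHom : F[X] →+* Module.End F (CInf F)
  exists_coeff : ∀ a : F[X], a ≠ 0 → ∃ c : ℕ → CInf F, c 0 = algebraMap F[X] (CInf F) a ∧
    c (r * a.natDegree) ≠ 0 ∧
    ∀ x, toRingHom a x = ∑ i ∈ Finset.range (r * a.natDegree + 1), c i * x ^ (Nat.card F ^ i)

/-- `Λ` is the period lattice of `φ`: it is a lattice of rank `r` such that
`φ_a(exp_Λ(x)) = exp_Λ(a x)`. -/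
structure DrinfeldModule.IsPeriodLattice {r : ℕ} (φ : DrinfeldModule F r)
    (Λ : Submodule F[X] (CInf F)) : Prop extends IsLattice Λ where
  finrank_eq : Module.finrank F[X] Λ = r
  map_exp : ∀ (a : F[X]) (x : CInf F),
    φ.toRingHom a (expLattice Λ x) = expLattice Λ (algebraMap F[X] (CInf F) a * x)

end Universal

end

/-!
Let `v` identify a finite additive group `B` with a subgroup of a field. A polynomial `P` with
`P(0) = 0` and degree less than `|B|` satisfies `∑ P(λ) / λ = -P'(0)` over the nonzero `λ ∈ B`, by
Lagrange interpolation on `B`. Take for `B` the elements of norm at most `q n` of a lattice `Λ` of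
rank `r`, and `P(x) = e_n(b x) ^ m`, where `e_n` is the product defining `exp_Λ` restricted to the
ball of radius `n`. Multiplication by `θ` shows that the ball of radius `q n` has `q ^ r` times as
many elements as that of radius `n`, so the identity holds whenever `m < q ^ r`. If `‖b‖ ≤ q⁻¹`,
then `e_n` and `exp_Λ` have the same absolute value at `b λ`, and `exp_Λ` is bounded on `K∞ Λ`, so
dominated convergence gives `∑ exp_Λ(b λ) ^ m / λ = -b` for `m = 1` and `0` for `1 < m < q ^ r`.

The functionals on `Ω` are the maps `res(b ·)` with `‖b‖ ≤ q⁻¹`, and at such a functional the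
pairing of `ζ` with the `k`-th twist of `ω` is `-∑ exp_Λ(b λ) ^ (q ^ k) / λ`. For `k = 0` this is
`b`, which represents `dθ / (θ ⊗ 1 - 1 ⊗ θ)`, and for `0 < k < r` it vanishes.
-/

section FiniteAddGroup

variable {G K : Type*} [AddGroup G] [Fintype G] [Field K] {v : G →+ K} {P : K[X]}

lemma sum_eval_eq_zero_of_natDegree_add_one_lt (hv : Function.Injective v)
    (hP : P.natDegree + 1 < Nat.card G) : ∑ g, P.eval (v g) = 0 := by
  classical
  have hcard : (Finset.univ : Finset G).card = Nat.card G := by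
    rw [Finset.card_univ, Nat.card_eq_fintype_card]
  have hdenominator (g : G) :
      ∏ u ∈ Finset.univ.erase g, (v g - v u) = ∏ u ∈ Finset.univ.erase 0, v u := by
    refine Finset.prod_nbij' (fun u => g - u) (fun u => -u + g) ?_ ?_ ?_ ?_ ?_ <;>
      simp [sub_eq_zero, eq_comm]
  have hinterpolation := Lagrange.coeff_eq_sum (s := Finset.univ) hv.injOn (P := P)
    (degree_le_natDegree.trans_lt (by rw [hcard]; exact_mod_cast by omega))
  rw [hcard, coeff_eq_zero_of_natDegree_lt (by omega)] at hinterpolation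
  simp only [hdenominator] at hinterpolation
  rw [← Finset.sum_div, eq_comm, div_eq_zero_iff] at hinterpolation
  refine hinterpolation.resolve_right (Finset.prod_ne_zero_iff.2 fun u hu => ?_)
  exact (map_ne_zero_iff v hv).2 (Finset.ne_of_mem_erase hu)

lemma sum_eval_div_eq_neg_coeff_one (hv : Function.Injective v) (h0 : P.coeff 0 = 0)
    (hP : P.natDegree < Nat.card G) : ∑ g, P.eval (v g) / v g = -P.coeff 1 := by
  classical
  obtain hconst | hpos := Nat.eq_zero_or_pos P.natDegree
  · have : P = 0 := by rw [eq_C_of_natDegree_eq_zero hconst, h0, C_0]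
    simp [this]
  have heval (x : K) : P.eval x = P.divX.eval x * x := by
    conv_lhs => rw [← divX_mul_X_add P, h0]
    simp
  have hterm (g : G) : P.eval (v g) / v g = P.divX.eval (v g) - if g = 0 then P.coeff 1 else 0 := by
    obtain rfl | hg := eq_or_ne g 0
    · simp [← coeff_zero_eq_eval_zero, coeff_divX]
    · rw [heval, mul_div_cancel_right₀ _ ((map_ne_zero_iff v hv).2 hg), if_neg hg, sub_zero]
  have hdivX : P.divX.natDegree + 1 < Nat.card G := by
    rw [natDegree_divX_eq_natDegree_tsub_one]
    omega
  simp only [hterm, Finset.sum_sub_distrib, sum_eval_eq_zero_of_natDegree_add_one_lt hv hdivX,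
    Finset.sum_ite_eq', Finset.mem_univ, if_true, zero_sub]

end FiniteAddGroup

section Polynomial

lemma coeff_one_pow_of_coeff_zero {R : Type*} [CommSemiring R] {P : R[X]} (h0 : P.coeff 0 = 0)
    {m : ℕ} (hm : m ≠ 0) : (P ^ m).coeff 1 = if m = 1 then P.coeff 1 else 0 := by
  obtain rfl | hm1 := eq_or_ne m 1
  · simp
  · obtain ⟨Q, rfl⟩ := X_dvd_iff.2 h0
    rw [mul_pow, coeff_X_pow_mul', if_neg (by omega), if_neg hm1]

variable {R M ι : Type*} [CommRing R] [AddCommGroup M] [Module R[X] M] [Fintype ι]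

lemma bijective_X_smul_add_sum_C_smul_basis (π : Module.Basis ι R[X] M) :
    Function.Bijective fun p : M × (ι → R) => (X : R[X]) • p.1 + ∑ i, C (p.2 i) • π i := by
  classical
  have hrepr (p : M × (ι → R)) (i : ι) :
      π.repr ((X : R[X]) • p.1 + ∑ i, C (p.2 i) • π i) i = π.repr p.1 i * X + C (p.2 i) := by
    simp [Finsupp.single_apply, mul_comm]
  refine ⟨fun p p' h => ?_, fun l => ?_⟩
  · have hcoord (i : ι) : π.repr p.1 i * X + C (p.2 i) = π.repr p'.1 i * X + C (p'.2 i) := by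
      rw [← hrepr, ← hrepr]
      exact congrArg (π.repr · i) h
    have hconst (i : ι) : p.2 i = p'.2 i := by simpa using congrArg (coeff · 0) (hcoord i)
    refine Prod.ext (π.ext_elem fun i => monic_X.isRegular.right ?_) (funext hconst)
    simpa [hconst] using hcoord i
  · refine ⟨(π.equivFun.symm fun i => (π.repr l i).divX, fun i => (π.repr l i).coeff 0),
      π.ext_elem fun i => ?_⟩
    rw [hrepr, ← π.equivFun_apply, LinearEquiv.apply_symm_apply, divX_mul_X_add]

end Polynomial

section Ultrametric

variable {E : Type*} [NormedAddCommGroup E] [IsUltrametricDist E]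

lemma norm_tsum_le_of_forall_norm_le {ι : Type*} {f : ι → E} {C : ℝ} (hC : 0 ≤ C)
    (hf : ∀ i, ‖f i‖ ≤ C) : ‖∑' i, f i‖ ≤ C := by
  by_cases hsummable : Summable f
  · exact le_of_tendsto hsummable.hasSum.norm <| Eventually.of_forall fun s =>
      IsUltrametricDist.norm_sum_le_of_forall_le_of_nonneg hC fun i _ => hf i
  · rwa [tsum_eq_zero_of_not_summable hsummable, norm_zero]

variable [CompleteSpace E]

lemma summable_of_norm_le_of_tendsto_zero {ι : Type*} {f : ι → E} {a : ι → ℝ}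
    (ha : Tendsto a cofinite (𝓝 0)) (hf : ∀ i, ‖f i‖ ≤ a i) : Summable f :=
  NonarchimedeanAddGroup.summable_of_tendsto_cofinite_zero (squeeze_zero_norm hf ha)

lemma summable_uncurry_of_finite_support {ι κ : Type*} {f : ι → κ → E} {a : κ → ℝ}
    (ha : Tendsto a cofinite (𝓝 0)) (hf : ∀ i k, ‖f i k‖ ≤ a k)
    (hfin : ∀ k, {i | f i k ≠ 0}.Finite) : Summable (Function.uncurry f) := by
  refine NonarchimedeanAddGroup.summable_of_tendsto_cofinite_zero ?_
  rw [Metric.tendsto_nhds]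
  intro ε hε
  have hlarge : {k | ¬ a k < ε}.Finite := ha.eventually_lt_const hε
  refine (hlarge.biUnion fun k _ => (hfin k).image fun i => (i, k)).subset ?_
  rintro ⟨i, k⟩ hik
  replace hik : ε ≤ ‖f i k‖ := by simpa using hik
  have hne : f i k ≠ 0 := norm_pos_iff.1 (hε.trans_le hik)
  exact Set.mem_biUnion (show k ∈ {k | ¬ a k < ε} from not_lt.2 (hik.trans (hf i k)))
    ⟨i, hne, rfl⟩

variable {ι α : Type*} {l : Filter α} [l.NeBot] {f : α → ι → E} {g : ι → E} {a : ι → ℝ}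

lemma tendsto_tsum_of_norm_le_of_tendsto_zero (ha : Tendsto a cofinite (𝓝 0))
    (hf : ∀ x i, ‖f x i‖ ≤ a i) (hg : ∀ i, Tendsto (f · i) l (𝓝 (g i))) :
    Tendsto (fun x => ∑' i, f x i) l (𝓝 (∑' i, g i)) := by
  have hg_norm (i : ι) : ‖g i‖ ≤ a i :=
    le_of_tendsto (hg i).norm (Eventually.of_forall fun x => hf x i)
  rw [Metric.tendsto_nhds]
  intro ε hε
  have hlarge : {i | ¬ a i < ε / 2}.Finite := ha.eventually_lt_const (half_pos hε)
  filter_upwards [hlarge.eventually_all.2 fun i _ =>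
    Metric.tendsto_nhds.1 (hg i) (ε / 2) (half_pos hε)] with x hx
  rw [dist_eq_norm, ← (summable_of_norm_le_of_tendsto_zero ha (hf x)).tsum_sub
    (summable_of_norm_le_of_tendsto_zero ha hg_norm)]
  refine (norm_tsum_le_of_forall_norm_le (half_pos hε).le fun i => ?_).trans_lt (half_lt_self hε)
  by_cases hi : a i < ε / 2
  · rw [sub_eq_add_neg]
    refine (IsUltrametricDist.norm_add_le_max _ _).trans (max_le ((hf x i).trans hi.le) ?_)
    exact (norm_neg _).trans_le ((hg_norm i).trans hi.le)
  · rw [← dist_eq_norm]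
    exact (hx i hi).le

lemma tendsto_sum_of_norm_le_of_tendsto_zero {s : α → Finset ι} (hs : Tendsto s l atTop)
    (ha : Tendsto a cofinite (𝓝 0)) (hf : ∀ x, ∀ i ∈ s x, ‖f x i‖ ≤ a i)
    (hg : ∀ i, Tendsto (f · i) l (𝓝 (g i))) :
    Tendsto (fun x => ∑ i ∈ s x, f x i) l (𝓝 (∑' i, g i)) := by
  have hmem (i : ι) : ∀ᶠ x in l, i ∈ s x := by
    filter_upwards [hs.eventually_ge_atTop {i}] with x hx
    exact Finset.singleton_subset_iff.1 hx
  have ha_nonneg (i : ι) : 0 ≤ a i := by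
    obtain ⟨x, hx⟩ := (hmem i).exists
    exact (norm_nonneg _).trans (hf x i hx)
  refine (tendsto_tsum_of_norm_le_of_tendsto_zero ha (fun x i => ?_) fun i =>
    (hg i).congr' ?_).congr fun x => (sum_eq_tsum_indicator (f x) (s x)).symm
  · by_cases hi : i ∈ s x
    · rw [Set.indicator_of_mem (Finset.mem_coe.2 hi)]
      exact hf x i hi
    · rw [Set.indicator_of_notMem (mt Finset.mem_coe.1 hi), norm_zero]
      exact ha_nonneg i
  · filter_upwards [hmem i] with x hx
    exact (Set.indicator_of_mem (Finset.mem_coe.2 hx) (f x)).symm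

end Ultrametric

section Lattice

variable {F : Type*} [Field F] [Finite F]

lemma CInf.norm_algebraMap_X : ‖algebraMap F[X] (CInf F) X‖ = Nat.card F := by
  rw [IsScalarTower.algebraMap_apply F[X] (KInf F) (CInf F), norm_algebraMap', KInf.algebraMap_X,
    KInf.norm_theta]

namespace IsLattice

variable {Λ : Submodule F[X] (CInf F)}

variable (Λ) in
/-- The elements of norm at most `n` of `Λ`, as an `F`-subspace. Its nonzero elements form
`IsLattice.ballFinset`. -/
def closedBall (n : ℕ) : Submodule F Λ where
  carrier := {l | ‖(l : CInf F)‖ ≤ n}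
  add_mem' hl hm := (IsUltrametricDist.norm_add_le_max _ _).trans (max_le hl hm)
  zero_mem' := by simp
  smul_mem' a l hl := (CInf.norm_fsmul_le a (l : CInf F)).trans hl

lemma mem_closedBall {n : ℕ} {l : Λ} : l ∈ closedBall Λ n ↔ ‖(l : CInf F)‖ ≤ n := Iff.rfl

lemma X_smul_mem_closedBall {n : ℕ} {l : Λ} :
    (X : F[X]) • l ∈ closedBall Λ (Nat.card F * n) ↔ l ∈ closedBall Λ n := by
  have hq : (0 : ℝ) < Nat.card F := by exact_mod_cast Nat.card_pos
  rw [mem_closedBall, Submodule.coe_smul, Algebra.smul_def, norm_mul, CInf.norm_algebraMap_X,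
    Nat.cast_mul, mul_le_mul_iff_right₀ hq, mem_closedBall]

lemma finite_closedBall (hΛ : IsLattice Λ) (n : ℕ) : Finite (closedBall Λ n) := by
  have : (closedBall Λ n : Set Λ).Finite :=
    ((hΛ.finite_ball n).preimage Subtype.val_injective.injOn).subset fun l hl => ⟨l.2, hl⟩
  exact this.to_subtype

lemma card_closedBall_card_mul {ι : Type*} [Fintype ι] (π : Module.Basis ι F[X] Λ) {n : ℕ}
    (hπ : ∀ i, π i ∈ closedBall Λ (Nat.card F * n)) :
    Nat.card (closedBall Λ (Nat.card F * n)) =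
      Nat.card (closedBall Λ n) * Nat.card F ^ Fintype.card ι := by
  have hmem (p : Λ × (ι → F)) : p.1 ∈ closedBall Λ n ↔
      (X : F[X]) • p.1 + ∑ i, C (p.2 i) • π i ∈ closedBall Λ (Nat.card F * n) := by
    rw [Submodule.add_mem_iff_left, X_smul_mem_closedBall]
    refine Submodule.sum_mem _ fun i _ => ?_
    rw [← algebraMap_eq, algebraMap_smul]
    exact Submodule.smul_mem _ _ (hπ i)
  let e := (Equiv.ofBijective _ (bijective_X_smul_add_sum_C_smul_basis π)).subtypeEquiv hmem
  rw [← Nat.card_congr e, Nat.card_congr Equiv.prodSubtypeFstEquivSubtypeProd, Nat.card_prod,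
    Nat.card_fun, Nat.card_eq_fintype_card (α := ι)]

lemma eventually_card_closedBall_card_mul (hΛ : IsLattice Λ) :
    ∀ᶠ n in atTop, Nat.card (closedBall Λ (Nat.card F * n)) =
      Nat.card (closedBall Λ n) * Nat.card F ^ Module.finrank F[X] Λ := by
  obtain ⟨_, _⟩ := hΛ.free
  let π := Module.finBasis F[X] Λ
  have hbasis : ∀ᶠ n : ℕ in atTop, ∀ i, ‖(π i : CInf F)‖ ≤ n :=
    eventually_all.2 fun i => tendsto_natCast_atTop_atTop.eventually_ge_atTop _
  filter_upwards [hbasis] with n hn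
  simpa using card_closedBall_card_mul π fun i => mem_closedBall.2 <| (hn i).trans
    (by exact_mod_cast Nat.le_mul_of_pos_left n Nat.card_pos)

lemma sum_closedBall {M : Type*} [AddCommMonoid M] (hΛ : IsLattice Λ) (n : ℕ)
    [Fintype (closedBall Λ n)] (f : Λ → M) :
    ∑ l : closedBall Λ n, f l = f 0 + ∑ l ∈ hΛ.ballFinset n, f l := by
  classical
  rw [← Finset.add_sum_erase _ _ (Finset.mem_univ 0)]
  congr 1
  refine Finset.sum_bij' (fun l hl => ⟨l, fun h => Finset.ne_of_mem_erase hl (Subtype.ext h)⟩)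
    (fun l hl => ⟨l, (hΛ.mem_ballFinset n l).1 hl⟩) (fun l _ => (hΛ.mem_ballFinset n _).2 l.2)
    (fun l _ => ?_) (fun _ _ => rfl) (fun _ _ => rfl) fun _ _ => rfl
  exact Finset.mem_erase.2 ⟨fun h => l.2 (congrArg Subtype.val h), Finset.mem_univ _⟩

lemma card_closedBall (hΛ : IsLattice Λ) (n : ℕ) :
    Nat.card (closedBall Λ n) = (hΛ.ballFinset n).card + 1 := by
  have := hΛ.finite_closedBall n
  have := Fintype.ofFinite (closedBall Λ n)
  simpa [Nat.card_eq_fintype_card, add_comm] using hΛ.sum_closedBall n fun _ => (1 : ℕ)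

/-- The polynomial `x ∏ (1 - x / λ)`, over the nonzero `λ ∈ Λ` of norm at most `n`: a partial
product of `exp_Λ`. -/
noncomputable def partialExp (hΛ : IsLattice Λ) (n : ℕ) : (CInf F)[X] :=
  X * ∏ l ∈ hΛ.ballFinset n, (1 - C ((l : Λ) : CInf F)⁻¹ * X)

lemma eval_partialExp (hΛ : IsLattice Λ) (n : ℕ) (x : CInf F) :
    (hΛ.partialExp n).eval x = x * ∏ l ∈ hΛ.ballFinset n, (1 - x / ((l : Λ) : CInf F)) := by
  simp [partialExp, eval_prod, div_eq_inv_mul]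

lemma tendsto_eval_partialExp (hΛ : IsLattice Λ) (x : CInf F) :
    Tendsto (fun n => (hΛ.partialExp n).eval x) atTop (𝓝 (expLattice Λ x)) := by
  simpa only [eval_partialExp] using hΛ.tendsto_exp x

lemma coeff_zero_partialExp (hΛ : IsLattice Λ) (n : ℕ) : (hΛ.partialExp n).coeff 0 = 0 := by
  simp [partialExp]

lemma coeff_one_partialExp (hΛ : IsLattice Λ) (n : ℕ) : (hΛ.partialExp n).coeff 1 = 1 := by
  simp [partialExp, coeff_X_mul, coeff_zero_eq_eval_zero, eval_prod]

lemma natDegree_partialExp_le (hΛ : IsLattice Λ) (n : ℕ) :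
    (hΛ.partialExp n).natDegree ≤ Nat.card (closedBall Λ n) := by
  rw [hΛ.card_closedBall, add_comm]
  refine natDegree_mul_le_of_le natDegree_X_le ((natDegree_prod_le _ _).trans ?_)
  refine (Finset.sum_le_card_nsmul _ _ 1 fun l _ => ?_).trans (by simp)
  compute_degree

lemma sum_eval_partialExp_pow_div (hΛ : IsLattice Λ) {n N m : ℕ} (hm : m ≠ 0)
    (hcard : Nat.card (closedBall Λ n) * m < Nat.card (closedBall Λ N)) (b : CInf F) :
    ∑ l ∈ hΛ.ballFinset N, (hΛ.partialExp n).eval (b * (l : Λ)) ^ m / ((l : Λ) : CInf F) =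
      -if m = 1 then b else 0 := by
  have := hΛ.finite_closedBall N
  have := Fintype.ofFinite (closedBall Λ N)
  let P := (hΛ.partialExp n).comp (C b * X)
  have hcoeff_zero : P.coeff 0 = 0 := by simp [P, comp_C_mul_X_coeff, coeff_zero_partialExp]
  have hcoeff_one : P.coeff 1 = b := by simp [P, comp_C_mul_X_coeff, coeff_one_partialExp]
  have hdegree : (P ^ m).natDegree < Nat.card (closedBall Λ N) := by
    refine (natDegree_pow_le.trans ?_).trans_lt hcard
    rw [mul_comm]
    gcongr
    calc P.natDegree ≤ (hΛ.partialExp n).natDegree * (C b * X).natDegree := natDegree_comp_le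
      _ ≤ (hΛ.partialExp n).natDegree * 1 := by
        gcongr
        exact (natDegree_C_mul_le b X).trans natDegree_X_le
      _ ≤ Nat.card (closedBall Λ n) := by rw [mul_one]; exact hΛ.natDegree_partialExp_le n
  let v : closedBall Λ N →+ CInf F :=
    Λ.subtype.toAddMonoidHom.comp (closedBall Λ N).subtype.toAddMonoidHom
  have hv : Function.Injective v := Subtype.val_injective.comp Subtype.val_injective
  have hsum := sum_eval_div_eq_neg_coeff_one (P := P ^ m) hv
    (by simpa [coeff_zero_eq_eval_zero, hm] using hcoeff_zero) hdegree
  rw [coeff_one_pow_of_coeff_zero hcoeff_zero hm, hcoeff_one] at hsum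
  rw [← hsum]
  have := hΛ.sum_closedBall N fun l => (P ^ m).eval (l : CInf F) / (l : CInf F)
  simpa [P, v, eval_comp] using this.symm

lemma norm_eval_partialExp (hΛ : IsLattice Λ) {n : ℕ} {x : CInf F} (hx : ‖x‖ ≤ n) :
    ‖(hΛ.partialExp n).eval x‖ = ‖expLattice Λ x‖ := by
  have hfactor (l : {l : Λ // l ≠ 0}) (hl : l ∉ hΛ.ballFinset n) :
      ‖1 - x / ((l : Λ) : CInf F)‖ = 1 := by
    rw [mem_ballFinset, not_le] at hl
    have hlt : ‖x / ((l : Λ) : CInf F)‖ < 1 := by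
      rw [norm_div]
      exact (div_lt_one ((norm_nonneg x).trans_lt (hx.trans_lt hl))).2 (hx.trans_lt hl)
    rw [← norm_one (α := CInf F), ← norm_neg] at hlt
    rw [sub_eq_add_neg, IsUltrametricDist.norm_add_eq_max_of_norm_ne_norm hlt.ne',
      max_eq_left hlt.le, norm_one]
  have hconst : ∀ᶠ N in atTop, ‖(hΛ.partialExp N).eval x‖ = ‖(hΛ.partialExp n).eval x‖ := by
    classical
    filter_upwards [hΛ.tendsto_ballFinset.eventually_ge_atTop (hΛ.ballFinset n)] with N hN
    rw [eval_partialExp, eval_partialExp, ← Finset.prod_sdiff hN, norm_mul, norm_mul, norm_mul,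
      norm_prod, Finset.prod_congr rfl fun l hl => hfactor l (Finset.mem_sdiff.1 hl).2,
      Finset.prod_const_one, one_mul]
  exact tendsto_nhds_unique (tendsto_nhds_of_eventually_eq hconst)
    (hΛ.tendsto_eval_partialExp x).norm

lemma exists_norm_expLattice_smul_le (hΛ : IsLattice Λ) :
    ∃ B, ∀ (b : KInf F) (l : Λ), ‖expLattice Λ (b • (l : CInf F))‖ ≤ B := by
  obtain ⟨ω, hω⟩ := hΛ.exists_universal
  obtain ⟨B, hB⟩ := CompletedTensor.exists_bound ω
  exact ⟨B, fun b l => hω b l ▸ hB _⟩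

lemma norm_eval_partialExp_smul_le (hΛ : IsLattice Λ) {b : KInf F} (hb : ‖b‖ ≤ (Nat.card F : ℝ)⁻¹)
    {B : ℝ} (hB : ∀ l : Λ, ‖expLattice Λ (b • (l : CInf F))‖ ≤ B) {n : ℕ} {l : Λ}
    (hl : l ∈ closedBall Λ (Nat.card F * n)) :
    ‖(hΛ.partialExp n).eval (b • (l : CInf F))‖ ≤ B := by
  have hq : (Nat.card F : ℝ) ≠ 0 := by exact_mod_cast Nat.card_pos.ne'
  rw [hΛ.norm_eval_partialExp]
  · exact hB l
  · calc ‖b • (l : CInf F)‖ = ‖b‖ * ‖(l : CInf F)‖ := norm_smul _ _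
      _ ≤ (Nat.card F : ℝ)⁻¹ * (Nat.card F * n : ℕ) := by gcongr; exact hl
      _ = n := by rw [Nat.cast_mul, inv_mul_cancel_left₀ hq]

theorem tsum_expLattice_pow_div (hΛ : IsLattice Λ) {b : KInf F} (hb : ‖b‖ ≤ (Nat.card F : ℝ)⁻¹)
    {m : ℕ} (hm : m ≠ 0) (hmr : m < Nat.card F ^ Module.finrank F[X] Λ) :
    ∑' l : {l : Λ // l ≠ 0}, expLattice Λ (b • ((l : Λ) : CInf F)) ^ m / ((l : Λ) : CInf F) =
      -if m = 1 then algebraMap (KInf F) (CInf F) b else 0 := by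
  obtain ⟨B, hB⟩ := hΛ.exists_norm_expLattice_smul_le
  have hball : Tendsto (fun n => hΛ.ballFinset (Nat.card F * n)) atTop atTop :=
    hΛ.tendsto_ballFinset.comp (tendsto_id.const_mul_atTop' Nat.card_pos)
  have hdominating : Tendsto (fun l : {l : Λ // l ≠ 0} => B ^ m * ‖((l : Λ) : CInf F)⁻¹‖) cofinite
      (𝓝 0) := by
    simpa using hΛ.tendsto_norm_inv.const_mul (B ^ m)
  have hlimit := tendsto_sum_of_norm_le_of_tendsto_zero hball
    (f := fun n (l : {l : Λ // l ≠ 0}) =>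
      (hΛ.partialExp n).eval (b • ((l : Λ) : CInf F)) ^ m / ((l : Λ) : CInf F))
    hdominating (fun n l hl => ?_) fun l => ((hΛ.tendsto_eval_partialExp _).pow m).div_const _
  · refine tendsto_nhds_unique hlimit (tendsto_nhds_of_eventually_eq ?_)
    filter_upwards [hΛ.eventually_card_closedBall_card_mul] with n hn
    have := hΛ.finite_closedBall n
    simp only [Algebra.smul_def]
    refine hΛ.sum_eval_partialExp_pow_div hm ?_ _
    rw [hn]
    exact Nat.mul_lt_mul_of_pos_left hmr Nat.card_pos
  · rw [div_eq_mul_inv, norm_mul, norm_pow]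
    gcongr
    exact hΛ.norm_eval_partialExp_smul_le hb (hB b) ((hΛ.mem_ballFinset _ l).1 hl)

end IsLattice

end Lattice

section Pairing

variable {F : Type*} [Field F] {L : Type*} [AddCommGroup L] [Module F[X] L] [Module F L]
  [IsScalarTower F F[X] L]

lemma evalDual_eq_sum_repr {ι : Type*} (β : Module.Basis ι F L) (l : L)
    (h : Module.Dual F Ω[F[X]⁄F]) :
    evalDual l h = (β.repr l).sum fun i a => a • evalDual (β i) h := by
  ext μ
  have hexpand := congrArg (h ∘ₗ μ.restrictScalars F) (β.linearCombination_repr l)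
  simpa [Finsupp.linearCombination_apply, Finsupp.sum, evalDual] using hexpand.symm

variable [Finite F]

lemma ev_eq_tsum_of_eq_tsum {κ : Type*} {c : κ → CInf F} {m : κ → L}
    (hc : Tendsto c cofinite (𝓝 0)) {x : CompletedTensor F L}
    (hx : ∀ g : Module.Dual F L, x g = ∑' k, g (m k) • c k)
    (y : CompletedTensor F (L →ₗ[F[X]] Ω[F[X]⁄F])) (h : Module.Dual F Ω[F[X]⁄F]) :
    ev x y h = ∑' k, c k * y (evalDual (m k) h) := by
  let β := Module.Basis.ofVectorSpace F L
  obtain ⟨B, hB⟩ := CompletedTensor.exists_bound y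
  let term (i) (k : κ) : CInf F := β.repr (m k) i • (c k * y (evalDual (β i) h))
  have hterm_norm (i) (k : κ) : ‖term i k‖ ≤ ‖c k‖ * B := by
    refine (CInf.norm_fsmul_le _ _).trans ?_
    rw [norm_mul]
    gcongr
    exact hB _
  have hterm_eq_zero {i} {k : κ} (hi : i ∉ (β.repr (m k)).support) : term i k = 0 := by
    simp only [term, Finsupp.notMem_support_iff.1 hi, zero_smul]
  have hsummable : Summable (Function.uncurry term) :=
    summable_uncurry_of_finite_support (by simpa using hc.norm.mul_const B) hterm_norm fun k =>
      (β.repr (m k)).support.finite_toSet.subset fun i hi => not_imp_comm.1 hterm_eq_zero hi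
  calc ev x y h = ∑' i, x (β.coord i) * y (evalDual (β i) h) := rfl
    _ = ∑' i, ∑' k, term i k := tsum_congr fun i => by
      rw [hx, ← tsum_mul_right]
      exact tsum_congr fun k => smul_mul_assoc _ _ _
    _ = ∑' k, ∑' i, term i k := hsummable.tsum_comm.symm
    _ = ∑' k, c k * y (evalDual (m k) h) := tsum_congr fun k => by
      rw [tsum_eq_sum fun i hi => hterm_eq_zero hi, evalDual_eq_sum_repr β, Finsupp.sum, map_sum,
        Finset.mul_sum]
      exact Finset.sum_congr rfl fun i _ => by rw [map_smul, mul_smul_comm]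

lemma IsLattice.ev_zeta {Λ : Submodule F[X] (CInf F)} (hΛ : IsLattice Λ)
    (y : CompletedTensor F (Λ →ₗ[F[X]] Ω[F[X]⁄F])) (h : Module.Dual F Ω[F[X]⁄F]) :
    ev hΛ.zeta y h =
      -∑' l : {l : Λ // l ≠ 0}, y (evalDual (l : Λ) h) / ((l : Λ) : CInf F) := by
  have hzeta (g : Module.Dual F Λ) :
      hΛ.zeta g = ∑' l : {l : Λ // l ≠ 0}, g l • -((l : Λ) : CInf F)⁻¹ := by
    simp only [smul_neg, tsum_neg]
    rfl
  have hcoeff : Tendsto (fun l : {l : Λ // l ≠ 0} => -((l : Λ) : CInf F)⁻¹) cofinite (𝓝 0) := by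
    simpa using (hΛ.tendsto_div 1).neg
  rw [ev_eq_tsum_of_eq_tsum hcoeff hzeta, ← tsum_neg]
  exact tsum_congr fun l => by ring

end Pairing

section Residue

variable {F : Type*} [Field F]

namespace KInf

/-- The element `∑ⱼ h(θʲ dθ) θ⁻ʲ⁻¹` of `K∞`, which represents the functional `h` on `Ω` as
`m ↦ res(b m)`. -/
noncomputable def ofDual (h : Module.Dual F Ω[F[X]⁄F]) : KInf F :=
  HahnSeries.ofPowerSeries ℤ F
    (PowerSeries.X * PowerSeries.mk fun j => h ((X ^ j : F[X]) • KaehlerDifferential.D F F[X] X))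

variable (h : Module.Dual F Ω[F[X]⁄F])

lemma coeff_ofDual_of_lt {n : ℤ} (hn : n < 1) : coeff n (ofDual h) = 0 := by
  refine (PowerSeries.coeff_coe _ n).trans ?_
  obtain hn | rfl := lt_or_eq_of_le (Int.le_of_lt_add_one hn : n ≤ 0)
  · exact if_pos hn
  · simp

lemma coeff_ofDual_succ (j : ℕ) :
    coeff (j + 1) (ofDual h) = h ((X ^ j : F[X]) • KaehlerDifferential.D F F[X] X) := by
  have := PowerSeries.coeff_succ_X_mul j
    (PowerSeries.mk fun j => h ((X ^ j : F[X]) • KaehlerDifferential.D F F[X] X))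
  rw [PowerSeries.coeff_mk] at this
  rw [← this, ← Nat.cast_succ]
  exact HahnSeries.ofPowerSeries_apply_coeff (Γ := ℤ) _ (j + 1)

lemma norm_ofDual_le [Finite F] : ‖ofDual h‖ ≤ (Nat.card F : ℝ)⁻¹ := by
  have := norm_le_theta_inv_pow (k := 1) fun n hn => coeff_ofDual_of_lt h (by exact_mod_cast hn)
  rwa [pow_one, norm_inv, norm_theta] at this

lemma dual_smul_D_eq_coeff_ofDual (p : F[X]) : h (p • KaehlerDifferential.D F F[X] X) =
    coeff 1 (ofDual h * algebraMap F[X] (KInf F) p) := by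
  induction p using Polynomial.induction_on' with
  | add p q hp hq =>
    rw [add_smul, map_add, hp, hq, map_add (algebraMap F[X] (KInf F)), mul_add, map_add]
  | monomial n a =>
    have hmonomial : algebraMap F[X] (KInf F) (monomial n a) = a • theta F ^ n := by
      rw [← smul_X_eq_monomial, Algebra.algebraMap_eq_smul_one, smul_assoc,
        ← Algebra.algebraMap_eq_smul_one, map_pow, algebraMap_X]
    rw [hmonomial, mul_smul_comm, map_smul (coeff 1), coeff_mul_theta_pow, add_comm,
      coeff_ofDual_succ, ← smul_X_eq_monomial, smul_assoc, map_smul h]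

lemma dual_eq_coeff_ofDual (m : Ω[F[X]⁄F]) : h m =
    coeff 1 (ofDual h * algebraMap F[X] (KInf F) (KaehlerDifferential.polynomialEquiv F m)) := by
  rw [← dual_smul_D_eq_coeff_ofDual]
  congr 1
  apply (KaehlerDifferential.polynomialEquiv F).injective
  simp

lemma ofDual_mul_theta :
    ofDual h * theta F - ofDual (LinearMap.lcomp F F (Algebra.lsmul F F Ω[F[X]⁄F] (X : F[X])) h) =
      algebraMap F (KInf F) (h (KaehlerDifferential.D F F[X] X)) := by
  set h' := LinearMap.lcomp F F (Algebra.lsmul F F Ω[F[X]⁄F] (X : F[X])) h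
  refine ext_coeff fun n => ?_
  rw [map_sub, ← pow_one (theta F), coeff_mul_theta_pow, Algebra.algebraMap_eq_smul_one, map_smul,
    ← mono_zero, coeff_mono, Nat.cast_one]
  obtain hn | rfl | hn := lt_trichotomy n 0
  · rw [coeff_ofDual_of_lt h (by omega), coeff_ofDual_of_lt h' (by omega), if_neg hn.ne]
    simp
  · rw [coeff_ofDual_of_lt h' (by omega)]
    simpa using coeff_ofDual_succ h 0
  · obtain ⟨j, rfl⟩ : ∃ j : ℕ, n = j + 1 := ⟨(n - 1).toNat, by omega⟩
    have := coeff_ofDual_succ h (j + 1)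
    push_cast at this
    rw [coeff_ofDual_succ, this, if_neg hn.ne', pow_succ', mul_smul, smul_zero]
    exact sub_self _

end KInf

variable [Finite F] {Λ : Submodule F[X] (CInf F)}

lemma evalDual_eq_resDual (l : Λ) (h : Module.Dual F Ω[F[X]⁄F]) :
    evalDual l h = resDual (KInf.ofDual h) l :=
  LinearMap.ext fun μ => KInf.dual_eq_coeff_ofDual h (μ l)

end Residue

namespace CompletedTensor

variable {F : Type*} [Field F] [Finite F]

lemma iterate_twist_apply {M : Type*} [AddCommGroup M] [Module F M] (f : CompletedTensor F M)
    (k : ℕ) (u : Module.Dual F M) : twist^[k] f u = f u ^ Nat.card F ^ k := by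
  induction k with
  | zero => simp
  | succ k ih =>
    rw [Function.iterate_succ_apply', pow_succ, pow_mul, ← ih]
    rfl

variable {M : Type*} [AddCommGroup M] [Module F M] [Module F[X] M] [IsScalarTower F F[X] M]

lemma eq_zero_of_leftMul_eq_rightMul {g : CompletedTensor F M}
    (hg : leftMul (algebraMap F[X] (CInf F) X) g = rightMul X g) : g = 0 := by
  refine Subtype.ext (LinearMap.ext fun h => ?_)
  change g h = 0
  obtain ⟨B, hB⟩ := exists_bound g
  have hmul (u : Module.Dual F M) : ∃ u', algebraMap F[X] (CInf F) X * g u = g u' :=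
    ⟨_, congrArg (fun f : CompletedTensor F M => f u) hg⟩
  have hpow (n : ℕ) : ∃ u, algebraMap F[X] (CInf F) X ^ n * g h = g u := by
    induction n with
    | zero => exact ⟨h, by simp⟩
    | succ n ih =>
      obtain ⟨u, hu⟩ := ih
      rw [pow_succ', mul_assoc, hu]
      exact hmul u
  by_contra hne
  obtain ⟨n, hn⟩ := pow_unbounded_of_one_lt (B / ‖g h‖)
    (by exact_mod_cast Finite.one_lt_card : (1 : ℝ) < Nat.card F)
  obtain ⟨u, hu⟩ := hpow n
  have := hB u
  rw [← hu, norm_mul, norm_pow, CInf.norm_algebraMap_X, ← le_div_iff₀ (norm_pos_iff.2 hne)] at this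
  exact hn.not_ge this

lemma leftMul_sub_rightMul_injective : Function.Injective fun g : CompletedTensor F M =>
    leftMul (algebraMap F[X] (CInf F) X) g - rightMul X g := by
  intro g g' heq
  refine sub_eq_zero.1 (eq_zero_of_leftMul_eq_rightMul (Subtype.ext (LinearMap.ext fun h => ?_)))
  have happly := congrArg (fun f : CompletedTensor F M => f h) heq
  let h' := LinearMap.lcomp F F (Algebra.lsmul F F M (X : F[X])) h
  change algebraMap F[X] (CInf F) X * g h - g h' =
    algebraMap F[X] (CInf F) X * g' h - g' h' at happly
  change algebraMap F[X] (CInf F) X * (g h - g' h) = g h' - g' h'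
  linear_combination happly

end CompletedTensor

section SpecialFunctions

variable {F : Type*} [Field F] [Finite F] {Λ : Submodule F[X] (CInf F)}

namespace IsLattice

lemma ev_zeta_iterate_twist_omega (hΛ : IsLattice Λ) {k : ℕ} (hk : k < Module.finrank F[X] Λ)
    (h : Module.Dual F Ω[F[X]⁄F]) :
    ev hΛ.zeta (CompletedTensor.twist^[k] hΛ.omega) h =
      if k = 0 then algebraMap (KInf F) (CInf F) (KInf.ofDual h) else 0 := by
  have homega (l : Λ) : hΛ.omega (evalDual l h) = expLattice Λ (KInf.ofDual h • (l : CInf F)) := by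
    rw [evalDual_eq_resDual]
    exact hΛ.existsUnique_universal.choose_spec.1 _ l
  have hq : 1 < Nat.card F := Finite.one_lt_card
  simp only [hΛ.ev_zeta, CompletedTensor.iterate_twist_apply, homega]
  rw [hΛ.tsum_expLattice_pow_div (KInf.norm_ofDual_le h) (pow_pos (by omega) k).ne'
    (Nat.pow_lt_pow_right hq hk), neg_neg]
  simp [hq.ne']

lemma leftMul_sub_rightMul_ev_zeta_omega (hΛ : IsLattice Λ)
    (hrank : 0 < Module.finrank F[X] Λ) :
    CompletedTensor.leftMul (algebraMap F[X] (CInf F) X) (ev hΛ.zeta hΛ.omega) -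
        CompletedTensor.rightMul X (ev hΛ.zeta hΛ.omega) =
      CompletedTensor.tmul 1 (KaehlerDifferential.D F F[X] X) := by
  refine Subtype.ext (LinearMap.ext fun h => ?_)
  let h' := LinearMap.lcomp F F (Algebra.lsmul F F Ω[F[X]⁄F] (X : F[X])) h
  have hev (u) : ev hΛ.zeta hΛ.omega u = algebraMap (KInf F) (CInf F) (KInf.ofDual u) :=
    hΛ.ev_zeta_iterate_twist_omega hrank u
  change algebraMap F[X] (CInf F) X * ev hΛ.zeta hΛ.omega h - ev hΛ.zeta hΛ.omega h' =
    h (KaehlerDifferential.D F F[X] X) • (1 : CInf F)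
  rw [hev, hev, IsScalarTower.algebraMap_apply F[X] (KInf F) (CInf F), KInf.algebraMap_X, mul_comm,
    ← map_mul, ← map_sub, KInf.ofDual_mul_theta, ← IsScalarTower.algebraMap_apply,
    Algebra.algebraMap_eq_smul_one]

end IsLattice

theorem mainTheorem4_general (hΛ : IsLattice Λ) (hrank : 0 < Module.finrank F[X] Λ) :
    (∀ g : CompletedTensor F Ω[F[X]⁄F],
      CompletedTensor.leftMul (algebraMap F[X] (CInf F) X) g - CompletedTensor.rightMul X g =
          CompletedTensor.tmul 1 (KaehlerDifferential.D F F[X] X) ↔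
        g = ev hΛ.zeta hΛ.omega) ∧
    ∀ k, 1 ≤ k → k < Module.finrank F[X] Λ →
      ev hΛ.zeta (CompletedTensor.twist^[k] hΛ.omega) = 0 := by
  refine ⟨fun g => ?_, fun k hk hkr => Subtype.ext (LinearMap.ext fun h => ?_)⟩
  · rw [← hΛ.leftMul_sub_rightMul_ev_zeta_omega hrank]
    exact CompletedTensor.leftMul_sub_rightMul_injective.eq_iff
  · exact (hΛ.ev_zeta_iterate_twist_omega hkr h).trans (if_neg (by omega))

end SpecialFunctions

/-- The first identity says that `ev(ζ ⊗ ω)` is the quotient of `dθ` by `θ ⊗ 1 - 1 ⊗ θ`, i.e. the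
unique solution `g ∈ ℂ∞ ⊗̂ Ω` of `(θ ⊗ 1 - 1 ⊗ θ) g = 1 ⊗ dθ`. -/
theorem mainTheorem4 {F : Type*} [Field F] [Finite F] {r : ℕ} (hr : 1 ≤ r)
    (φ : DrinfeldModule F r) (Λ : Submodule F[X] (CInf F)) (hΛ : φ.IsPeriodLattice Λ) :
    (∀ g : CompletedTensor F Ω[F[X]⁄F],
      CompletedTensor.leftMul (algebraMap F[X] (CInf F) X) g - CompletedTensor.rightMul X g =
          CompletedTensor.tmul 1 (KaehlerDifferential.D F F[X] X) ↔
        g = ev hΛ.toIsLattice.zeta hΛ.toIsLattice.omega) ∧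
    (2 ≤ r → ev hΛ.toIsLattice.zeta (CompletedTensor.twist hΛ.toIsLattice.omega) = 0) := by
  obtain rfl := hΛ.finrank_eq
  exact (mainTheorem4_general hΛ.toIsLattice hr).imp_right fun hvanish => hvanish 1 le_rfl
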